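/- **Notation.** Let $A\in\mathbb R^{m\times n}$, let $t_2=\max_j(\sum_i a_{ij}^2)^{1/2}$ be the maximum $\ell_2$-norm of a column of $A$, and let $x\in[0,1]^n$. For $y\in[0,1]^n$ call coordinate $j$ *alive* at $y$ if $0<y_j<1$, and let $n_y$ be the number of alive coordinates. Row $i$ is *big* at $y$ if $\sum_{j\text{ alive}}a_{ij}^2>2t_2^2$, and $W_y$ is the span of the big rows restricted to the alive coordinates. Put $\delta=\tfrac12$, $a=\delta/10$, $\eta=10/(9\delta)$, $\gamma=1/(2n^{3/2})$. A positive semidefinite matrix $U$ indexed by the alive coordinates is *admissible* at $y$ if $w^TUw=0$ for all $w\in W_y$, $U_{ii}\le1$ for all $i$, $\operatorname{Tr}U\ge a\,n_y$, and $U\preceq\eta\,\mathrm{diag}(U)$. **Algorithm.** Start with $x^{(0)}=x$. As long as $x^{(k)}\notin\{0,1\}^n$, take an admissible $U$ at $x^{(k)}$ (chosen by any fixed rule as a function of $x^{(k)}$) and a fresh vector $r_k$ of independent uniform $\pm1$ entries, and set $x^{(k+1)}=x^{(k)}+\gamma_kU^{1/2}r_k$ on the alive coordinates, where $\gamma_k$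 is the largest value in $(0,\gamma]$ such that $x^{(k)}\pm\gamma_kU^{1/2}r_k\in[0,1]^n$; frozen (not alive) coordinates are left unchanged. Return the final point $X$. **Theorem (Komlós setting).** There are universal constants $\beta\ge1$ and $K>0$, and for every $c>0$ a constant $C>0$ depending only on $c$, such that for all $m,n$ and all $A$ an admissible matrix exists at every $y\in[0,1]^n$, and for every rule selecting admissible matrices and every $x\in[0,1]^n$: 1. With probability $1$ the algorithm terminates and returns $X\in\{0,1\}^n$; the expected number of iterations is at most $Kn^4$ (that is, $O(n/\gamma^2)$). 2. $\mathbb E[X_i]=x_i$ for all $i$, and $X$ is $\beta$-concentrated: for every $b\in\mathbb R^n$ and $t\ge0$, with $M=\max_i|b_i|$, $$\Pr\big[b\cdot X-\mathbb E[b\cdot X]\ge t\big]\le\exp\Big(-\frac{t^2/\beta}{2\big(\sum_ib_i^2(x_i-x_i^2)+Mt/3\big)}\Big)$$ (for $b=0$ the bound is read as the trivial bound $1$). 3. If $m\ge2$, then with probability at least $1-m^{-c}$, $\;|A(X-x)|_\infty\le C\,t_2\sqrt{\log m}$. -/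

import Mathlib

open MeasureTheory
open scoped ENNReal MatrixOrder

noncomputable section

namespace SubIsotropic

variable {m n : ℕ}

/-- The maximum Euclidean norm of a column of `A`. -/
def maxColNorm (A : Matrix (Fin m) (Fin n) ℝ) : ℝ :=
  ⨆ j, √(∑ i, A i j ^ 2)

/-- The fractional points, i.e. the cube `[0,1]^n`. -/
def cube (n : ℕ) : Set (Fin n → ℝ) := {x | ∀ i, 0 ≤ x i ∧ x i ≤ 1}

/-- A vector all of whose entries are `0` or `1`. -/
def IsZeroOne (x : Fin n → ℝ) : Prop := ∀ i, x i = 0 ∨ x i = 1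

open Classical in
/-- The alive coordinates of a fractional point; the other coordinates are frozen. -/
def alive (x : Fin n → ℝ) : Finset (Fin n) :=
  Finset.univ.filter fun i => 0 < x i ∧ x i < 1

/-- The amount of slack. -/
def slack : ℝ := 1 / 2

/-- Row `i` is big at `x` if its squared Euclidean norm, restricted to the alive coordinates,
exceeds `2 t₂²`, where `t₂` is the maximum column norm of the whole matrix. -/
def IsBigRow (A : Matrix (Fin m) (Fin n) ℝ) (x : Fin n → ℝ) (i : Fin m) : Prop :=
  2 * maxColNorm A ^ 2 < ∑ j ∈ alive x, A i j ^ 2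

/-- The subspace spanned by the big rows, each restricted to the alive coordinates
(and extended by zero to the frozen ones). -/
def protectedSpace (A : Matrix (Fin m) (Fin n) ℝ) (x : Fin n → ℝ) :
    Submodule ℝ (Fin n → ℝ) :=
  Submodule.span ℝ
    {w | ∃ i, IsBigRow A x i ∧ w = fun j => if j ∈ alive x then A i j else 0}

/-- The matrices that the algorithm may use as covariance matrix at the point `x`, with parameters
`a = δ / 10` and `η = 10 / (9 δ)`. A matrix indexed by the alive coordinates is represented by its
extension by zero. -/
structure IsUpdateCovariance (A : Matrix (Fin m) (Fin n) ℝ) (x : Fin n → ℝ)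
    (U : Matrix (Fin n) (Fin n) ℝ) : Prop where
  posSemidef : U.PosSemidef
  supported : ∀ i, i ∉ alive x → ∀ j, U i j = 0 ∧ U j i = 0
  orthogonal : ∀ w ∈ protectedSpace A x, w ⬝ᵥ (U.mulVec w) = 0
  diag_le_one : ∀ i, U i i ≤ 1
  trace_ge : slack / 10 * ((alive x).card : ℝ) ≤ U.trace
  subIsotropic :
    ((10 / (9 * slack)) • Matrix.diagonal (fun i => U i i) - U).PosSemidef

/-- A (deterministic) rule that selects an admissible covariance matrix at every fractional
point. -/
def IsCovarianceRule (A : Matrix (Fin m) (Fin n) ℝ)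
    (rule : (Fin n → ℝ) → Matrix (Fin n) (Fin n) ℝ) : Prop :=
  ∀ x ∈ cube n, IsUpdateCovariance A x (rule x)

/-- The sequences of coin tosses: in each iteration one fair coin for each coordinate. -/
abbrev Coins (n : ℕ) : Type := ℕ → Fin n → Bool

/-- All coins are independent and fair. -/
def coinMeasure (n : ℕ) : Measure (Coins n) :=
  Measure.infinitePi fun _ : ℕ =>
    Measure.pi fun _ : Fin n => (PMF.uniformOfFintype Bool).toMeasure

/-- The sign vector given by one round of coins. -/
def signs (b : Fin n → Bool) : Fin n → ℝ := fun i => if b i then 1 else -1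

/-- The default step size `γ = 1 / (2 n^{3/2})`. -/
def maxStep (n : ℕ) : ℝ := 1 / (2 * (n : ℝ) ^ (3 / 2 : ℝ))

/-- The largest `g ∈ (0, γ]` such that both `x + g d` and `x - g d` lie in the cube. -/
def stepSize (x d : Fin n → ℝ) : ℝ :=
  sSup {g | 0 < g ∧ g ≤ maxStep n ∧ x + g • d ∈ cube n ∧ x - g • d ∈ cube n}

/-- One update `x ↦ x + γₖ U^{1/2} r`; `CFC.sqrt U` is the positive semidefinite square root. -/
def update (U : Matrix (Fin n) (Fin n) ℝ) (x r : Fin n → ℝ) : Fin n → ℝ :=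
  x + stepSize x ((CFC.sqrt U).mulVec r) • (CFC.sqrt U).mulVec r

/-- The point after `k` iterations. -/
def iterate (rule : (Fin n → ℝ) → Matrix (Fin n) (Fin n) ℝ) (x : Fin n → ℝ)
    (ω : Coins n) : ℕ → Fin n → ℝ
  | 0 => x
  | k + 1 => update (rule (iterate rule x ω k)) (iterate rule x ω k) (signs (ω k))

/-- The number of iterations until all coordinates are `0` or `1`
(meaningful on the runs that terminate). -/
def numIter (rule : (Fin n → ℝ) → Matrix (Fin n) (Fin n) ℝ) (x : Fin n → ℝ)
    (ω : Coins n) : ℕ :=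
  sInf {k | IsZeroOne (iterate rule x ω k)}

/-- The vector returned by the algorithm. -/
def output (rule : (Fin n → ℝ) → Matrix (Fin n) (Fin n) ℝ) (x : Fin n → ℝ)
    (ω : Coins n) : Fin n → ℝ :=
  iterate rule x ω (numIter rule x ω)

/-- `X` is a random `0`-`1` vector with mean `x` that satisfies Bernstein's inequality up to the
factor `β` in the exponent, for every linear function. -/
structure IsConcentrated {Ω : Type*} [MeasurableSpace Ω] (P : Measure Ω)
    (X : Ω → Fin n → ℝ) (x : Fin n → ℝ) (β : ℝ) : Prop where
  zeroOne : ∀ᵐ ω ∂P, IsZeroOne (X ω)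
  integrable : ∀ i, Integrable (fun ω => X ω i) P
  mean : ∀ i, ∫ ω, X ω i ∂P = x i
  tail : ∀ (a : Fin n → ℝ) (t : ℝ), 0 ≤ t →
    P.real {ω | t ≤ a ⬝ᵥ X ω - ∫ ω', a ⬝ᵥ X ω' ∂P} ≤
      Real.exp (-(t ^ 2 / β) /
        (2 * (∑ i, a i ^ 2 * (x i - x i ^ 2) + (⨆ i, |a i|) * t / 3)))

end SubIsotropic

end

noncomputable section

open scoped BigOperators Matrix Topology

namespace SubIsotropic

variable {m n : ℕ}

/-! ### Averages over sign vectors -/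

/-! The core is a supermartingale: if all `|a i| ≤ 1/500`, then `exp (a ⬝ᵥ x + potential a x)` does
not increase on average in one step (`expect_exp_update_le`). The part of a step's change that is
linear in the increment Δ has mean zero, so its second moment must be paid for by the concavity of
the potential, essentially by a multiple of Σ aᵢ² E Δᵢ². If every step had length γ, then U ⪯ η
diag(U) would give this at once. When the cube shortens a step, E Δᵢ² can fall below γ² Uᵢᵢ, but by
at most p/(4n²), where p is the probability of shortening (`maxStep_sq_mul_diag_le`). A shortened
step or its mirror image under r ↦ -r freezes a coordinate, so p is at most twice the probability of
freezing (`shortProb_le_expect_freezes`). Freezing lowers the part of the potential that is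
proportional to the number of alive coordinates, and this pays for the loss. The payment is too
small for coordinates within 1/n of 0 or 1. For these, correlations are ignored: Cauchy–Schwarz
costs a factor n, and `weight` has curvature of order n there.

As the potential lies between 0 and 752 Σ aᵢ²(xᵢ - xᵢ²), Chernoff's method gives the Bernstein
bound. For the discrepancy, a big row does not move. Once a row is small, its coefficients up to
t₂/√(log m) are handled by exponential moments, and its larger ones contribute at most 2 t₂ √(log m)
deterministically. A union bound finishes. For termination, `remaining` drops by at least 1 on
average per unfinished step, by the same trade between variance and freezing.

Admissible matrices exist by duality. If none did, Hahn–Banach separation would give a form F that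
dominates η times its diagonal on a large subspace. After rescaling F to unit diagonal, its trace is
too small for that (`mul_card_sub_finrank_le`). -/

theorem signs_not (b : Fin n → Bool) : signs (fun i => !b i) = -signs b := by
  ext i
  cases h : b i <;> simp [signs, h]

theorem expect_not (F : (Fin n → Bool) → ℝ) :
    𝔼 b : Fin n → Bool, F (fun i => !b i) = 𝔼 b, F b :=
  Fintype.expect_equiv (Equiv.arrowCongr (Equiv.refl (Fin n)) Equiv.boolNot) _ _ fun _ => rfl

/-- Gives the increments mean zero, although the length of a step depends on the coins. -/
theorem expect_eq_zero_of_odd (F : (Fin n → Bool) → ℝ) (h : ∀ b, F (fun i => !b i) = -F b) :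
    𝔼 b, F b = 0 := by
  have h1 := expect_not F
  simp only [h, Finset.expect_neg_distrib] at h1
  linarith

theorem signs_sq (b : Fin n → Bool) (i : Fin n) : signs b i * signs b i = 1 := by
  cases h : b i <;> simp [signs, h]

theorem expect_signs_mul (i j : Fin n) :
    𝔼 b, signs b i * signs b j = if i = j then 1 else 0 := by
  split_ifs with h
  · subst h
    simp [signs_sq]
  -- Flipping coin `i` alone permutes the outcomes and reverses the sign of the product.
  · have h1 : 𝔼 b, signs b i * signs b j
        = 𝔼 b, signs (Function.update b i (!b i)) i * signs (Function.update b i (!b i)) j := by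
      refine (Fintype.expect_equiv (Function.Involutive.toPerm
        (fun b : Fin n → Bool => Function.update b i (!b i)) ?_) _ _ fun b => rfl).symm
      intro b
      simp
    have h2 : ∀ b : Fin n → Bool,
        signs (Function.update b i (!b i)) i * signs (Function.update b i (!b i)) j
          = -(signs b i * signs b j) := by
      intro b
      have : j ≠ i := fun h' => h h'.symm
      cases hb : b i <;> cases hb' : b j <;> simp [signs, hb, hb', this]
    simp only [h2, Finset.expect_neg_distrib] at h1
    linarith

theorem expect_dotProduct_signs_sq (c : Fin n → ℝ) : 𝔼 b, (c ⬝ᵥ signs b) ^ 2 = c ⬝ᵥ c := by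
  have h : ∀ b : Fin n → Bool,
      (c ⬝ᵥ signs b) ^ 2 = ∑ i, ∑ j, c i * c j * (signs b i * signs b j) := by
    intro b
    rw [sq, dotProduct, Finset.sum_mul_sum]
    refine Finset.sum_congr rfl fun i _ => Finset.sum_congr rfl fun j _ => by ring
  simp_rw [h, Finset.expect_sum_comm, ← Finset.mul_expect, expect_signs_mul]
  simp [dotProduct]

/-! ### The direction of a step -/

/-- The direction in which the algorithm moves, for a given round of coins. -/
def direction (U : Matrix (Fin n) (Fin n) ℝ) (b : Fin n → Bool) : Fin n → ℝ :=
  (CFC.sqrt U).mulVec (signs b)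

theorem direction_not (U : Matrix (Fin n) (Fin n) ℝ) (b : Fin n → Bool) :
    direction U (fun i => !b i) = -direction U b := by
  rw [direction, signs_not, Matrix.mulVec_neg, direction]

theorem sqrt_mul_sqrt {U : Matrix (Fin n) (Fin n) ℝ} (hU : U.PosSemidef) :
    CFC.sqrt U * CFC.sqrt U = U :=
  CFC.sqrt_mul_sqrt_self U hU.nonneg

theorem sqrt_apply_comm (U : Matrix (Fin n) (Fin n) ℝ) (i j : Fin n) :
    CFC.sqrt U i j = CFC.sqrt U j i := by
  have := (Matrix.nonneg_iff_posSemidef.mp (CFC.sqrt_nonneg U)).isHermitian.apply i j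
  simpa using this.symm

theorem sqrt_transpose (U : Matrix (Fin n) (Fin n) ℝ) : (CFC.sqrt U)ᵀ = CFC.sqrt U := by
  ext i j
  exact sqrt_apply_comm U j i

theorem dotProduct_direction (U : Matrix (Fin n) (Fin n) ℝ) (c : Fin n → ℝ) (b : Fin n → Bool) :
    c ⬝ᵥ direction U b = (CFC.sqrt U *ᵥ c) ⬝ᵥ signs b := by
  rw [direction, Matrix.dotProduct_mulVec, ← Matrix.mulVec_transpose, sqrt_transpose]

theorem sqrt_mulVec_dotProduct_self {U : Matrix (Fin n) (Fin n) ℝ} (hU : U.PosSemidef)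
    (c : Fin n → ℝ) : (CFC.sqrt U *ᵥ c) ⬝ᵥ (CFC.sqrt U *ᵥ c) = c ⬝ᵥ U *ᵥ c := by
  conv_rhs => rw [← sqrt_mul_sqrt hU, ← Matrix.mulVec_mulVec, Matrix.dotProduct_mulVec,
    ← Matrix.mulVec_transpose, sqrt_transpose]

theorem expect_dotProduct_direction_sq {U : Matrix (Fin n) (Fin n) ℝ} (hU : U.PosSemidef)
    (c : Fin n → ℝ) : 𝔼 b, (c ⬝ᵥ direction U b) ^ 2 = c ⬝ᵥ U *ᵥ c := by
  simp_rw [dotProduct_direction, expect_dotProduct_signs_sq, sqrt_mulVec_dotProduct_self hU]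

theorem dotProduct_direction_eq_zero {U : Matrix (Fin n) (Fin n) ℝ} (hU : U.PosSemidef)
    {c : Fin n → ℝ} (hc : c ⬝ᵥ U *ᵥ c = 0) (b : Fin n → Bool) : c ⬝ᵥ direction U b = 0 := by
  rw [← sqrt_mulVec_dotProduct_self hU, dotProduct_self_eq_zero] at hc
  rw [dotProduct_direction, hc, zero_dotProduct]

theorem single_dotProduct_mulVec_single (U : Matrix (Fin n) (Fin n) ℝ) (i : Fin n) :
    Pi.single i 1 ⬝ᵥ U *ᵥ Pi.single i 1 = U i i := by
  simp

theorem expect_direction_sq {U : Matrix (Fin n) (Fin n) ℝ} (hU : U.PosSemidef) (i : Fin n) :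
    𝔼 b, direction U b i ^ 2 = U i i := by
  have := expect_dotProduct_direction_sq hU (Pi.single i 1)
  simpa using this

theorem direction_eq_zero {U : Matrix (Fin n) (Fin n) ℝ} (hU : U.PosSemidef) {i : Fin n}
    (hi : U i i = 0) (b : Fin n → Bool) : direction U b i = 0 := by
  have := dotProduct_direction_eq_zero hU (c := Pi.single i 1) (by simpa using hi) b
  simpa using this

/-- Cauchy–Schwarz for row `i` of the square root of `U`, whose squared norm is `U i i`. -/
theorem direction_sq_le {U : Matrix (Fin n) (Fin n) ℝ} (hU : U.PosSemidef) (b : Fin n → Bool)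
    (i : Fin n) : direction U b i ^ 2 ≤ n * U i i := by
  have h := Finset.sum_mul_sq_le_sq_mul_sq Finset.univ (fun j => CFC.sqrt U i j) (signs b)
  have h2 : U i i = ∑ j, CFC.sqrt U i j ^ 2 := by
    conv_lhs => rw [← sqrt_mul_sqrt hU, Matrix.mul_apply]
    refine Finset.sum_congr rfl fun j _ => ?_
    rw [sqrt_apply_comm U j i, sq]
  have h3 : ∑ j, signs b j ^ 2 = n := by simp [sq, signs_sq]
  rw [h3, ← h2] at h
  calc direction U b i ^ 2 = (∑ j, CFC.sqrt U i j * signs b j) ^ 2 := rfl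
    _ ≤ U i i * n := h
    _ = n * U i i := mul_comm _ _

/-- A matrix dominated by a multiple of its diagonal. -/
theorem dotProduct_mulVec_le {U : Matrix (Fin n) (Fin n) ℝ} {η : ℝ}
    (hU : (η • Matrix.diagonal (fun i => U i i) - U).PosSemidef) (c : Fin n → ℝ) :
    c ⬝ᵥ U *ᵥ c ≤ η * ∑ i, c i ^ 2 * U i i := by
  have h := hU.dotProduct_mulVec_nonneg c
  rw [Matrix.sub_mulVec, Matrix.smul_mulVec, dotProduct_sub, dotProduct_smul] at h
  have h2 : star c ⬝ᵥ Matrix.diagonal (fun i => U i i) *ᵥ c = ∑ i, c i ^ 2 * U i i := by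
    simp only [dotProduct, Matrix.mulVec_diagonal]
    refine Finset.sum_congr rfl fun i _ => ?_
    simp only [Pi.star_apply, star_trivial]
    ring
  rw [h2] at h
  simpa using h

/-! ### The step size -/

theorem mem_alive {x : Fin n → ℝ} {i : Fin n} : i ∈ alive x ↔ 0 < x i ∧ x i < 1 := by
  simp [alive]

theorem maxStep_pos (hn : 0 < n) : 0 < maxStep n := by
  have : (0 : ℝ) < n := by exact_mod_cast hn
  unfold maxStep
  positivity

theorem maxStep_sq (n : ℕ) : maxStep n ^ 2 = 1 / (4 * (n : ℝ) ^ 3) := by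
  have h : ((n : ℝ) ^ (3 / 2 : ℝ)) ^ 2 = (n : ℝ) ^ 3 := by
    rw [← Real.rpow_natCast, ← Real.rpow_mul (Nat.cast_nonneg n), ← Real.rpow_natCast]
    norm_num
  rw [maxStep, div_pow, mul_pow, h]
  norm_num

/-- The distance of a number in `[0,1]` from the ends of this interval. -/
def margin (t : ℝ) : ℝ := min t (1 - t)

theorem margin_nonneg {x : Fin n → ℝ} (hx : x ∈ cube n) (i : Fin n) : 0 ≤ margin (x i) :=
  le_min (hx i).1 (by linarith [(hx i).2])

theorem margin_pos_iff {x : Fin n → ℝ} {i : Fin n} : 0 < margin (x i) ↔ i ∈ alive x := by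
  rw [mem_alive, margin, lt_min_iff, sub_pos]

theorem add_sub_smul_mem_cube_iff {x d : Fin n → ℝ} {g : ℝ} (hg : 0 < g) :
    x + g • d ∈ cube n ∧ x - g • d ∈ cube n ↔ ∀ i, g * |d i| ≤ margin (x i) := by
  simp only [cube, Set.mem_ofPred_eq, Pi.add_apply, Pi.sub_apply, Pi.smul_apply, smul_eq_mul, margin,
    ← forall_and]
  refine forall_congr' fun i => ?_
  rw [le_min_iff, ← abs_of_pos hg, ← abs_mul, abs_of_pos hg, abs_le, abs_le]
  constructor <;> intro h <;> refine ⟨⟨?_, ?_⟩, ?_, ?_⟩ <;> linarith [h.1.1, h.1.2, h.2.1, h.2.2]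

theorem mem_stepSize_set_iff {x d : Fin n → ℝ} {g : ℝ} :
    g ∈ {g | 0 < g ∧ g ≤ maxStep n ∧ x + g • d ∈ cube n ∧ x - g • d ∈ cube n} ↔
      0 < g ∧ g ≤ maxStep n ∧ ∀ i, g * |d i| ≤ margin (x i) := by
  rw [Set.mem_ofPred_eq]
  refine and_congr_right fun hg => and_congr_right fun _ => ?_
  exact add_sub_smul_mem_cube_iff hg

/-- Because both `x + g d` and `x - g d` are kept in the cube, the step size is even in `d`, so the
increment is odd in the coins. -/
theorem stepSize_neg (x d : Fin n → ℝ) : stepSize x (-d) = stepSize x d := by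
  unfold stepSize
  congr 1
  ext g
  rw [mem_stepSize_set_iff, mem_stepSize_set_iff]
  simp

theorem eventually_mul_abs_le {x d : Fin n → ℝ} (hx : x ∈ cube n) {s : ℝ}
    (h : ∀ i, d i = 0 ∨ s * |d i| < margin (x i)) :
    ∀ᶠ g in 𝓝[>] s, ∀ i, g * |d i| ≤ margin (x i) := by
  rw [Filter.eventually_all]
  intro i
  rcases h i with h | h
  · simp [h, margin_nonneg hx i]
  · have h1 : Filter.Tendsto (fun g : ℝ => g * |d i|) (𝓝[>] s) (𝓝 (s * |d i|)) :=
      ((continuous_id.mul continuous_const).tendsto s).mono_left nhdsWithin_le_nhds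
    exact (h1.eventually_lt_const h).mono fun g hg => hg.le

/-- With `s = 0` this shows that the supremum defining `stepSize` is over a nonempty set; with `s =
stepSize x d` it contradicts maximality unless some margin is used up. -/
theorem exists_mem_stepSize_set {x d : Fin n → ℝ} (hx : x ∈ cube n) {s : ℝ} (hs : 0 ≤ s)
    (hs' : s < maxStep n) (h : ∀ i, d i = 0 ∨ s * |d i| < margin (x i)) :
    ∃ g, s < g ∧ g ∈ {g | 0 < g ∧ g ≤ maxStep n ∧ x + g • d ∈ cube n ∧ x - g • d ∈ cube n} := by
  have h1 : ∀ᶠ g in 𝓝[>] s, g ≤ maxStep n :=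
    ((Filter.tendsto_id.mono_left nhdsWithin_le_nhds).eventually_lt_const hs').mono
      fun g hg => le_of_lt hg
  obtain ⟨g, ⟨h2, h3⟩, h4⟩ := ((eventually_mul_abs_le hx h).and h1).and
    (self_mem_nhdsWithin : Set.Ioi s ∈ 𝓝[>] s) |>.exists
  exact ⟨g, h4, mem_stepSize_set_iff.2 ⟨hs.trans_lt h4, h3, h2⟩⟩

theorem bddAbove_stepSize_set (x d : Fin n → ℝ) :
    BddAbove {g | 0 < g ∧ g ≤ maxStep n ∧ x + g • d ∈ cube n ∧ x - g • d ∈ cube n} :=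
  ⟨maxStep n, fun _ hg => hg.2.1⟩

section

variable {x d : Fin n → ℝ}

theorem stepSize_spec (hn : 0 < n) (hx : x ∈ cube n) (hd : ∀ i, i ∉ alive x → d i = 0) :
    0 < stepSize x d ∧ stepSize x d ≤ maxStep n ∧ ∀ i, stepSize x d * |d i| ≤ margin (x i) := by
  obtain ⟨g, hg, hg'⟩ := exists_mem_stepSize_set (d := d) hx le_rfl (maxStep_pos hn) fun i => by
    by_cases hi : i ∈ alive x
    · right; simpa using margin_pos_iff.2 hi
    · exact Or.inl (hd i hi)
  refine ⟨hg.trans_le (le_csSup (bddAbove_stepSize_set x d) hg'),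
    csSup_le ⟨g, hg'⟩ fun _ h => h.2.1, fun i => ?_⟩
  rcases eq_or_ne (d i) 0 with h0 | h0
  · simpa [h0] using margin_nonneg hx i
  · have h1 : 0 < |d i| := abs_pos.2 h0
    rw [← le_div_iff₀ h1]
    refine csSup_le ⟨g, hg'⟩ fun g' h => ?_
    rw [le_div_iff₀ h1]
    exact (mem_stepSize_set_iff.1 h).2.2 i

theorem exists_stepSize_mul_eq_margin (hn : 0 < n) (hx : x ∈ cube n)
    (hd : ∀ i, i ∉ alive x → d i = 0) (hs : stepSize x d < maxStep n) :
    ∃ i, d i ≠ 0 ∧ stepSize x d * |d i| = margin (x i) := by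
  obtain ⟨h1, -, h3⟩ := stepSize_spec hn hx hd
  by_contra! hcon
  obtain ⟨g, hg, hg'⟩ := exists_mem_stepSize_set (d := d) hx h1.le hs fun i => by
    rcases eq_or_ne (d i) 0 with h0 | h0
    · exact Or.inl h0
    · exact Or.inr (lt_of_le_of_ne (h3 i) (hcon i h0))
  exact absurd (le_csSup (bddAbove_stepSize_set x d) hg') (not_le.2 hg)

end

/-! ### The increment of one step -/

/-- The change of the fractional point in one iteration. -/
def increment (U : Matrix (Fin n) (Fin n) ℝ) (x : Fin n → ℝ) (b : Fin n → Bool) : Fin n → ℝ :=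
  stepSize x (direction U b) • direction U b

theorem update_eq (U : Matrix (Fin n) (Fin n) ℝ) (x : Fin n → ℝ) (b : Fin n → Bool) :
    update U x (signs b) = x + increment U x b := rfl

theorem increment_not (U : Matrix (Fin n) (Fin n) ℝ) (x : Fin n → ℝ) (b : Fin n → Bool) :
    increment U x (fun i => !b i) = -increment U x b := by
  rw [increment, direction_not, stepSize_neg, smul_neg, increment]

theorem expect_dotProduct_increment (U : Matrix (Fin n) (Fin n) ℝ) (x c : Fin n → ℝ) :
    𝔼 b, c ⬝ᵥ increment U x b = 0 :=
  expect_eq_zero_of_odd _ fun b => by rw [increment_not, dotProduct_neg]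

theorem dotProduct_increment_eq_zero {U : Matrix (Fin n) (Fin n) ℝ} (hU : U.PosSemidef)
    {c : Fin n → ℝ} (hc : c ⬝ᵥ U *ᵥ c = 0) (x : Fin n → ℝ) (b : Fin n → Bool) :
    c ⬝ᵥ increment U x b = 0 := by
  rw [increment, dotProduct_smul, dotProduct_direction_eq_zero hU hc, smul_zero]

section

variable {A : Matrix (Fin m) (Fin n) ℝ} {x : Fin n → ℝ} {U : Matrix (Fin n) (Fin n) ℝ}

theorem IsUpdateCovariance.direction_eq_zero (hU : IsUpdateCovariance A x U) (b : Fin n → Bool)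
    (i : Fin n) (hi : i ∉ alive x) : direction U b i = 0 :=
  SubIsotropic.direction_eq_zero hU.posSemidef (hU.supported i hi i).1 b

theorem IsUpdateCovariance.increment_eq_zero (hU : IsUpdateCovariance A x U) (b : Fin n → Bool)
    {i : Fin n} (hi : i ∉ alive x) : increment U x b i = 0 := by
  simp [increment, hU.direction_eq_zero b i hi]

variable (hn : 0 < n) (hx : x ∈ cube n) (hU : IsUpdateCovariance A x U)
include hn hx hU

theorem abs_increment (b : Fin n → Bool) (i : Fin n) :
    |increment U x b i| = stepSize x (direction U b) * |direction U b i| := by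
  have h := (stepSize_spec hn hx (hU.direction_eq_zero b)).1
  rw [increment, Pi.smul_apply, smul_eq_mul, abs_mul, abs_of_pos h]

theorem abs_increment_le_margin (b : Fin n → Bool) (i : Fin n) :
    |increment U x b i| ≤ margin (x i) := by
  rw [abs_increment hn hx hU]
  exact (stepSize_spec hn hx (hU.direction_eq_zero b)).2.2 i

/-- The choice of γ: γ² = 1/(4n³) times the bound n on the squared direction is (1/(2n))². The
increment is then half the width 1/n that separates coordinates near the ends from central ones. -/
theorem abs_increment_le (b : Fin n → Bool) (i : Fin n) :
    |increment U x b i| ≤ 1 / (2 * n) := by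
  have hn' : (0 : ℝ) < n := by exact_mod_cast hn
  obtain ⟨h1, h2, -⟩ := stepSize_spec hn hx (hU.direction_eq_zero b)
  have h3 : increment U x b i ^ 2 ≤ (1 / (2 * n)) ^ 2 := by
    calc increment U x b i ^ 2 = stepSize x (direction U b) ^ 2 * direction U b i ^ 2 := by
          simp [increment, mul_pow]
      _ ≤ maxStep n ^ 2 * (n * 1) := by
          gcongr
          exact (direction_sq_le hU.posSemidef b i).trans (by gcongr; exact hU.diag_le_one i)
      _ = (1 / (2 * n)) ^ 2 := by
          rw [maxStep_sq]; field_simp; norm_num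
  exact abs_le_of_sq_le_sq h3 (by positivity)

theorem update_mem_cube (b : Fin n → Bool) : update U x (signs b) ∈ cube n := by
  intro i
  have h := abs_increment_le_margin hn hx hU b i
  rw [margin, le_min_iff, abs_le, abs_le] at h
  rw [update_eq, Pi.add_apply]
  constructor <;> linarith [h.1.1, h.2.2]

omit hn hx in
theorem alive_update_subset (b : Fin n → Bool) : alive (update U x (signs b)) ⊆ alive x := by
  intro i hi
  by_contra h
  rw [mem_alive, update_eq, Pi.add_apply, hU.increment_eq_zero b h, add_zero] at hi
  exact h (mem_alive.2 hi)

/-- A shortened step freezes a coordinate, or the opposite step does. -/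
theorem card_alive_update_lt (b : Fin n → Bool) (hb : stepSize x (direction U b) < maxStep n) :
    (alive (update U x (signs b))).card < (alive x).card ∨
      (alive (update U x (signs fun i => !b i))).card < (alive x).card := by
  obtain ⟨i, hi, hi'⟩ := exists_stepSize_mul_eq_margin hn hx (hU.direction_eq_zero b) hb
  rw [← abs_increment hn hx hU] at hi'
  have hi0 : i ∈ alive x := by
    by_contra h
    exact hi (hU.direction_eq_zero b i h)
  have key : i ∉ alive (update U x (signs b)) ∨ i ∉ alive (update U x (signs fun i => !b i)) := by
    simp only [mem_alive, update_eq, increment_not, Pi.add_apply, Pi.neg_apply, not_and_or, not_lt]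
    -- The step exhausts the distance to the nearer end. Either it moves towards that end, or the
    -- opposite step does.
    rcases abs_choice (increment U x b i) with h | h <;>
      rcases min_choice (x i) (1 - x i) with h' | h' <;>
      rw [h, margin, h'] at hi'
    · exact Or.inr (Or.inl (by linarith))
    · exact Or.inl (Or.inr (by linarith))
    · exact Or.inl (Or.inl (by linarith))
    · exact Or.inr (Or.inr (by linarith))
  refine key.imp (fun h => ?_) fun h => ?_
  · exact Finset.card_lt_card ((Finset.ssubset_iff_of_subset (alive_update_subset hU b)).2
      ⟨i, hi0, h⟩)
  · exact Finset.card_lt_card ((Finset.ssubset_iff_of_subset (alive_update_subset hU _)).2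
      ⟨i, hi0, h⟩)

end

/-! ### Shortened steps: their frequency and their cost in variance. -/

open Classical in
/-- The probability that the step is shortened. -/
def shortProb (U : Matrix (Fin n) (Fin n) ℝ) (x : Fin n → ℝ) : ℝ :=
  𝔼 b, if stepSize x (direction U b) < maxStep n then 1 else 0

open Classical in
/-- The indicator of the event that a coordinate is frozen. -/
def freezes (U : Matrix (Fin n) (Fin n) ℝ) (x : Fin n → ℝ) (b : Fin n → Bool) : ℝ :=
  if (alive (update U x (signs b))).card < (alive x).card then 1 else 0

theorem freezes_nonneg (U : Matrix (Fin n) (Fin n) ℝ) (x : Fin n → ℝ) (b : Fin n → Bool) :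
    0 ≤ freezes U x b := by
  unfold freezes
  split_ifs <;> norm_num

theorem freezes_le_one (U : Matrix (Fin n) (Fin n) ℝ) (x : Fin n → ℝ) (b : Fin n → Bool) :
    freezes U x b ≤ 1 := by
  unfold freezes
  split_ifs <;> norm_num

theorem shortProb_nonneg (U : Matrix (Fin n) (Fin n) ℝ) (x : Fin n → ℝ) : 0 ≤ shortProb U x :=
  Finset.expect_nonneg fun b _ => by split_ifs <;> norm_num

section

variable {A : Matrix (Fin m) (Fin n) ℝ} {x : Fin n → ℝ} {U : Matrix (Fin n) (Fin n) ℝ}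

theorem card_alive_update_add_freezes_le (hU : IsUpdateCovariance A x U) (b : Fin n → Bool) :
    ((alive (update U x (signs b))).card : ℝ) + freezes U x b ≤ (alive x).card := by
  have h := Finset.card_le_card (alive_update_subset hU b)
  unfold freezes
  split_ifs with h'
  · exact_mod_cast h'
  · simpa using h

variable (hn : 0 < n) (hx : x ∈ cube n) (hU : IsUpdateCovariance A x U)
include hn hx hU

/-- Each coin vector is paired with its negation: if the step is shortened, at least one of the two
freezes a coordinate. -/
theorem shortProb_le_expect_freezes : shortProb U x ≤ 2 * 𝔼 b, freezes U x b := by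
  have h : 𝔼 b, (freezes U x b + freezes U x fun i => !b i) = 2 * 𝔼 b, freezes U x b := by
    rw [Finset.expect_add_distrib, expect_not (freezes U x)]
    ring
  rw [← h]
  refine Finset.expect_le_expect fun b _ => ?_
  split_ifs with hb
  · rcases card_alive_update_lt hn hx hU b hb with h' | h'
    · have : freezes U x b = 1 := if_pos h'
      linarith [freezes_nonneg U x fun i => !b i]
    · have : (freezes U x fun i => !b i) = 1 := if_pos h'
      linarith [freezes_nonneg U x b]
  · linarith [freezes_nonneg U x b, freezes_nonneg U x fun i => !b i]

open Classical in
/-- The loss of variance in a coordinate that is due to shortened steps. -/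
theorem maxStep_sq_mul_diag_le (i : Fin n) :
    maxStep n ^ 2 * U i i ≤ 𝔼 b, increment U x b i ^ 2 + shortProb U x / (4 * n ^ 2) := by
  have hn' : (0 : ℝ) < n := by exact_mod_cast hn
  rw [← expect_direction_sq hU.posSemidef i, shortProb, Finset.mul_expect, Finset.expect_div,
    ← Finset.expect_add_distrib]
  refine Finset.expect_le_expect fun b _ => ?_
  obtain ⟨h1, h2, -⟩ := stepSize_spec hn hx (hU.direction_eq_zero b)
  have h4 : increment U x b i ^ 2 = stepSize x (direction U b) ^ 2 * direction U b i ^ 2 := by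
    simp [increment, mul_pow]
  split_ifs with hb
  -- A shortened step may lose its whole variance, which is at most γ² n = 1/(4n²).
  · have h3 : maxStep n ^ 2 * direction U b i ^ 2 ≤ maxStep n ^ 2 * (n * 1) := by
      gcongr
      exact (direction_sq_le hU.posSemidef b i).trans (by gcongr; exact hU.diag_le_one i)
    have h5 : maxStep n ^ 2 * (n * 1) = 1 / (4 * (n : ℝ) ^ 2) := by
      rw [maxStep_sq]; field_simp
    have := sq_nonneg (increment U x b i)
    linarith
  · rw [h4, le_antisymm h2 (not_lt.1 hb)]
    simp

/-- The increments are sub-isotropic up to an error caused by shortened steps. -/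
theorem expect_dotProduct_increment_sq_le (c : Fin n → ℝ) :
    𝔼 b, (c ⬝ᵥ increment U x b) ^ 2 ≤
      10 / (9 * slack) * ∑ i, c i ^ 2 *
        (𝔼 b, increment U x b i ^ 2 + shortProb U x / (4 * n ^ 2)) := by
  have hs : (0 : ℝ) ≤ 10 / (9 * slack) := by norm_num [slack]
  calc 𝔼 b, (c ⬝ᵥ increment U x b) ^ 2
      ≤ 𝔼 b, maxStep n ^ 2 * (c ⬝ᵥ direction U b) ^ 2 := by
        -- Shortening is harmless in this upper bound. Its cost enters at the end, where γ² `U i i`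
        -- is replaced by the true variance.
        refine Finset.expect_le_expect fun b _ => ?_
        obtain ⟨h1, h2, -⟩ := stepSize_spec hn hx (hU.direction_eq_zero b)
        rw [increment, dotProduct_smul, smul_eq_mul, mul_pow]
        gcongr
    _ = maxStep n ^ 2 * (c ⬝ᵥ U *ᵥ c) := by
        rw [← Finset.mul_expect, expect_dotProduct_direction_sq hU.posSemidef]
    _ ≤ maxStep n ^ 2 * (10 / (9 * slack) * ∑ i, c i ^ 2 * U i i) := by
        gcongr
        exact dotProduct_mulVec_le hU.subIsotropic c
    _ = 10 / (9 * slack) * ∑ i, c i ^ 2 * (maxStep n ^ 2 * U i i) := by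
        rw [Finset.mul_sum, Finset.mul_sum, Finset.mul_sum]
        exact Finset.sum_congr rfl fun i _ => by ring
    _ ≤ _ := by
        gcongr with i
        exact maxStep_sq_mul_diag_le hn hx hU i

end

/-! ### A concave weight on the unit interval -/

/-- A concave function on `[0,∞)` whose second derivative is of order `-n` on `[0,1/n]`. -/
def saturation (n : ℕ) (t : ℝ) : ℝ := t / (1 + n * t)

/-- The function is fractional linear, so the remainder after the linear term is explicit; it is
nonpositive here. -/
theorem saturation_add {t δ : ℝ} (ht : 0 ≤ t) (hδ : 0 ≤ t + δ) :
    saturation n (t + δ) = saturation n t + (1 / (1 + n * t) ^ 2) * δ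
      - n / ((1 + n * t) ^ 2 * (1 + n * (t + δ))) * δ ^ 2 := by
  have hn : (0 : ℝ) ≤ n := Nat.cast_nonneg n
  have h1 : 0 < 1 + n * t := by positivity
  have h2 : 0 < 1 + n * (t + δ) := by positivity
  unfold saturation
  field_simp
  ring

theorem saturation_add_le {t δ : ℝ} (ht : 0 ≤ t) (hδ : 0 ≤ t + δ) :
    saturation n (t + δ) ≤ saturation n t + (1 / (1 + n * t) ^ 2) * δ := by
  have : 0 ≤ n / ((1 + n * t) ^ 2 * (1 + n * (t + δ))) * δ ^ 2 := by positivity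
  rw [saturation_add ht hδ]
  linarith

/-- Here `n t ≤ 1` and `n (t + δ) ≤ 2`, so the denominator of the remainder is at most 2² · 3 = 12.
-/
theorem saturation_add_le_sub {t δ : ℝ} (hn : 0 < n) (ht : 0 ≤ t) (hδ : |δ| ≤ t)
    (ht' : t ≤ 1 / n) :
    saturation n (t + δ) ≤ saturation n t + (1 / (1 + n * t) ^ 2) * δ - n / 12 * δ ^ 2 := by
  have hn' : (0 : ℝ) < n := by exact_mod_cast hn
  obtain ⟨h1, h2⟩ := abs_le.1 hδ
  have h0 : 0 ≤ t + δ := by linarith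
  have h3 : n * t ≤ 1 := by
    rw [le_div_iff₀ hn'] at ht'
    linarith
  have h4 : n * (t + δ) ≤ 2 := by nlinarith
  have h5 : (1 + n * t) ^ 2 * (1 + n * (t + δ)) ≤ 12 := by
    calc (1 + n * t) ^ 2 * (1 + n * (t + δ)) ≤ (1 + 1) ^ 2 * (1 + 2) := by gcongr
      _ = 12 := by norm_num
  have h6 : (n : ℝ) / 12 ≤ n / ((1 + n * t) ^ 2 * (1 + n * (t + δ))) := by gcongr
  rw [saturation_add ht h0]
  nlinarith [sq_nonneg δ]

theorem saturation_le {t : ℝ} (ht : 0 ≤ t) : saturation n t ≤ t := by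
  unfold saturation
  exact div_le_self ht (by nlinarith [mul_nonneg (Nat.cast_nonneg (α := ℝ) n) ht])

theorem saturation_mono {s t : ℝ} (hs : 0 ≤ s) (hst : s ≤ t) :
    saturation n s ≤ saturation n t := by
  have h1 : 0 ≤ (n : ℝ) * s := by positivity
  have h2 : 0 ≤ (n : ℝ) * t := mul_nonneg (Nat.cast_nonneg n) (hs.trans hst)
  unfold saturation
  rw [div_le_div_iff₀ (by linarith) (by linarith)]
  nlinarith

/-- The weight of a coordinate in the potential function. -/
def weight (n : ℕ) (t : ℝ) : ℝ :=
  48 * (t * (1 - t)) + 256 * (saturation n t + saturation n (1 - t) - saturation n 1)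

/-- The slope of `weight`. -/
def weightSlope (n : ℕ) (t : ℝ) : ℝ :=
  48 * (1 - 2 * t) + 256 * (1 / (1 + n * t) ^ 2 - 1 / (1 + n * (1 - t)) ^ 2)

/-- Monotonicity and `saturation n t ≤ t` bound the bracket in `weight` by min(t, 1 - t) ≤ 2t(1 -
t), and 560 = 48 + 2 · 256. -/
theorem weight_le {t : ℝ} (h0 : 0 ≤ t) (h1 : t ≤ 1) : weight n t ≤ 560 * (t * (1 - t)) := by
  have h2 : saturation n t ≤ t := saturation_le h0
  have h3 : saturation n (1 - t) ≤ 1 - t := saturation_le (by linarith)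
  have h4 : saturation n t ≤ saturation n 1 := saturation_mono h0 h1
  have h5 : saturation n (1 - t) ≤ saturation n 1 := saturation_mono (by linarith) (by linarith)
  unfold weight
  rcases le_total t (1 / 2) with h | h <;> nlinarith

theorem abs_weightSlope_le {t : ℝ} (h0 : 0 ≤ t) (h1 : t ≤ 1) : |weightSlope n t| ≤ 304 := by
  have key : ∀ s : ℝ, 0 ≤ s → 0 ≤ 1 / (1 + n * s) ^ 2 ∧ 1 / (1 + n * s) ^ 2 ≤ 1 := by
    intro s hs
    have : 0 ≤ (n : ℝ) * s := by positivity
    refine ⟨by positivity, ?_⟩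
    rw [div_le_one (by positivity)]
    nlinarith
  obtain ⟨h2, h3⟩ := key t h0
  obtain ⟨h4, h5⟩ := key (1 - t) (by linarith)
  rw [weightSlope, abs_le]
  constructor <;> linarith

/-- The curvature of `weight`. -/
def weightCurvature (n : ℕ) (t : ℝ) : ℝ := 48 + if margin t ≤ 1 / n then 64 / 3 * (n : ℝ) else 0

/-- The parabola contributes curvature 48. Near an end, the saturation at that end adds 256 · n/12 =
64n/3; otherwise the saturations are used only as concave functions. -/
theorem weight_add_le {t δ : ℝ} (hn : 0 < n) (hδ : |δ| ≤ margin t) :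
    weight n (t + δ) ≤ weight n t + weightSlope n t * δ - weightCurvature n t * δ ^ 2 := by
  have hm := hδ
  rw [margin, le_min_iff] at hδ
  obtain ⟨h1, h2⟩ := hδ
  have ht : 0 ≤ t := (abs_nonneg _).trans h1
  have ht' : 0 ≤ 1 - t := (abs_nonneg _).trans h2
  have h3 := abs_le.1 h1
  have h4 := abs_le.1 h2
  have e : 1 - (t + δ) = (1 - t) + -δ := by ring
  have a1 := saturation_add_le (n := n) (t := t) (δ := δ) ht (by linarith)
  have a2 := saturation_add_le (n := n) (t := 1 - t) (δ := -δ) ht' (by linarith)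
  unfold weight weightSlope weightCurvature
  rw [e]
  split_ifs with h
  · rw [margin, min_le_iff] at h
    rcases h with h | h
    · have a3 := saturation_add_le_sub hn ht h1 h
      linarith
    · have a3 := saturation_add_le_sub (δ := -δ) hn ht' (by rwa [abs_neg]) h
      linarith
  · linarith

theorem weightCurvature_nonneg (t : ℝ) : 0 ≤ weightCurvature n t := by
  unfold weightCurvature
  split_ifs <;> positivity

theorem weightCurvature_le (hn : 0 < n) (t : ℝ) : weightCurvature n t ≤ 70 * n := by
  have hn' : (1 : ℝ) ≤ n := by exact_mod_cast hn
  unfold weightCurvature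
  split_ifs <;> linarith

/-- A central coordinate still has variance of order 1/n after the step; a drop in the number of
alive coordinates is multiplied by it. -/
theorem le_mul_one_sub_of_margin {t δ : ℝ} (hn : 0 < n) (ht : 1 / n < margin t)
    (hδ : |δ| ≤ 1 / (2 * n)) : 1 / (8 * n) ≤ (t + δ) * (1 - (t + δ)) := by
  have hn' : (1 : ℝ) ≤ n := by exact_mod_cast hn
  rw [margin, lt_min_iff] at ht
  have h := abs_le.1 hδ
  set e : ℝ := 1 / (2 * n) with he
  have h1 : 1 / (n : ℝ) = 2 * e := by rw [he]; field_simp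
  have h2 : 1 / (8 * n : ℝ) = e / 4 := by rw [he]; field_simp; norm_num
  have h3 : e ≤ 1 / 2 := by rw [he, div_le_div_iff₀ (by positivity) (by norm_num)]; linarith
  have h4 : 0 < e := by rw [he]; positivity
  rw [h1] at ht
  rw [h2]
  nlinarith [mul_nonneg (by linarith : 0 ≤ t + δ - e) (by linarith : 0 ≤ 1 - (t + δ) - e)]

/-! ### The potential function -/

/-- The potential that compensates the fluctuations of `a ⬝ᵥ x`. -/
def potential (a x : Fin n → ℝ) : ℝ :=
  ∑ i, a i ^ 2 * weight n (x i) +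
    192 * ((alive x).card / n) * ∑ i, a i ^ 2 * (x i * (1 - x i))

theorem card_alive_div_le (x : Fin n → ℝ) : ((alive x).card : ℝ) / n ≤ 1 := by
  refine div_le_one_of_le₀ ?_ (Nat.cast_nonneg n)
  exact_mod_cast (Finset.card_le_univ (alive x)).trans_eq (Fintype.card_fin n)

theorem potential_le {a x : Fin n → ℝ} (hx : x ∈ cube n) :
    potential a x ≤ 752 * ∑ i, a i ^ 2 * (x i - x i ^ 2) := by
  have h0 : 0 ≤ ∑ i, a i ^ 2 * (x i * (1 - x i)) := Finset.sum_nonneg fun i _ =>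
    mul_nonneg (sq_nonneg _) (mul_nonneg (hx i).1 (by linarith [(hx i).2]))
  have h1 : ∑ i, a i ^ 2 * weight n (x i) ≤ 560 * ∑ i, a i ^ 2 * (x i * (1 - x i)) := by
    rw [Finset.mul_sum]
    refine Finset.sum_le_sum fun i _ => ?_
    nlinarith [weight_le (n := n) (hx i).1 (hx i).2, sq_nonneg (a i)]
  have h2 : ∑ i, a i ^ 2 * (x i - x i ^ 2) = ∑ i, a i ^ 2 * (x i * (1 - x i)) :=
    Finset.sum_congr rfl fun i _ => by ring
  have h3 := mul_le_mul_of_nonneg_right (card_alive_div_le x) h0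
  rw [h2, potential]
  linarith

/-- The coefficient of the linear part of the change of `a ⬝ᵥ x + potential a x`. -/
def slope (a x : Fin n → ℝ) (i : Fin n) : ℝ :=
  a i + a i ^ 2 * (weightSlope n (x i) + 192 * ((alive x).card / n) * (1 - 2 * x i))

/-- The origin of 1/500: the correction is at most (304 + 192) `a i ^ 2`, hence at most `|a i|`. -/
theorem abs_slope_le {a x : Fin n → ℝ} (hx : x ∈ cube n) (ha : ∀ i, |a i| ≤ 1 / 500)
    (i : Fin n) : |slope a x i| ≤ 2 * |a i| := by
  have h1 := abs_weightSlope_le (n := n) (hx i).1 (hx i).2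
  have h2 : |192 * (((alive x).card : ℝ) / n) * (1 - 2 * x i)| ≤ 192 * 1 * 1 := by
    rw [abs_mul, abs_mul]
    gcongr
    · norm_num
    · rw [abs_of_nonneg (by positivity)]; exact card_alive_div_le x
    · rw [abs_le]; constructor <;> linarith [(hx i).1, (hx i).2]
  have h3 := abs_add_le (weightSlope n (x i)) (192 * (((alive x).card : ℝ) / n) * (1 - 2 * x i))
  have h4 := abs_add_le (a i) (a i ^ 2 * (weightSlope n (x i) +
    192 * ((alive x).card / n) * (1 - 2 * x i)))
  rw [abs_mul, abs_pow] at h4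
  unfold slope
  nlinarith [ha i, abs_nonneg (a i), mul_nonneg (abs_nonneg (a i)) (sub_nonneg.2 (ha i)),
    mul_nonneg (sq_nonneg |a i|) (sub_nonneg.2 (h3.trans (add_le_add h1 h2)))]

/-- The weight of the coordinates that are not close to `0` or `1`. -/
def centralMass (a x : Fin n → ℝ) : ℝ := ∑ i, if margin (x i) ≤ 1 / n then 0 else a i ^ 2

theorem centralMass_nonneg (a x : Fin n → ℝ) : 0 ≤ centralMass a x :=
  Finset.sum_nonneg fun i _ => by split_ifs <;> positivity

/-- The compensation for the quadratic part of the change of `a ⬝ᵥ x + potential a x`. -/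
def compensation (a : Fin n → ℝ) (U : Matrix (Fin n) (Fin n) ℝ) (x : Fin n → ℝ)
    (b : Fin n → Bool) : ℝ :=
  ∑ i, a i ^ 2 * (weightCurvature n (x i) * increment U x b i ^ 2) +
    24 / n ^ 2 * centralMass a x * freezes U x b

theorem compensation_nonneg (a : Fin n → ℝ) (U : Matrix (Fin n) (Fin n) ℝ) (x : Fin n → ℝ)
    (b : Fin n → Bool) : 0 ≤ compensation a U x b := by
  have h1 := centralMass_nonneg a x
  have h2 := freezes_nonneg U x b
  have h4 : 0 ≤ ∑ i, a i ^ 2 * (weightCurvature n (x i) * increment U x b i ^ 2) :=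
    Finset.sum_nonneg fun i _ => mul_nonneg (sq_nonneg _) (mul_nonneg (weightCurvature_nonneg _) (sq_nonneg _))
  unfold compensation
  positivity

section

variable {A : Matrix (Fin m) (Fin n) ℝ} {x : Fin n → ℝ} {U : Matrix (Fin n) (Fin n) ℝ}

variable (hn : 0 < n) (hx : x ∈ cube n) (hU : IsUpdateCovariance A x U)
include hn hx hU

/-- The curvature of `weight` is kept, that of the second sum of `potential` is discarded. A
freezing step lowers the factor of this sum by at least 192/n while the sum stays at least
`centralMass`/(8n), which gives the coefficient 24/n². -/
theorem dotProduct_add_potential_update_le (a : Fin n → ℝ) (b : Fin n → Bool) :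
    a ⬝ᵥ update U x (signs b) + potential a (update U x (signs b)) ≤
      a ⬝ᵥ x + potential a x + (slope a x ⬝ᵥ increment U x b - compensation a U x b) := by
  have hn' : (0 : ℝ) < n := by exact_mod_cast hn
  set Δ := increment U x b with hΔ
  set x' := update U x (signs b) with hx'
  have e : ∀ i, x' i = x i + Δ i := fun i => rfl
  have hx'c : x' ∈ cube n := update_mem_cube hn hx hU b
  set N : ℝ := ((alive x).card : ℝ) with hN
  set N' : ℝ := ((alive x').card : ℝ) with hN'
  have hNN : N' + freezes U x b ≤ N := card_alive_update_add_freezes_le hU b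
  have h1 : ∑ i, a i ^ 2 * weight n (x' i) ≤ ∑ i, (a i ^ 2 * weight n (x i)
      + a i ^ 2 * weightSlope n (x i) * Δ i
      - a i ^ 2 * (weightCurvature n (x i) * Δ i ^ 2)) := by
    refine Finset.sum_le_sum fun i _ => ?_
    have := weight_add_le hn (abs_increment_le_margin hn hx hU b i)
    rw [e]
    nlinarith [mul_le_mul_of_nonneg_left this (sq_nonneg (a i))]
  set V' := ∑ i, a i ^ 2 * (x' i * (1 - x' i)) with hV'
  set V := ∑ i, a i ^ 2 * (x i * (1 - x i)) with hV
  have h2 : V' ≤ V + ∑ i, a i ^ 2 * (1 - 2 * x i) * Δ i := by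
    rw [hV, hV', ← Finset.sum_add_distrib]
    refine Finset.sum_le_sum fun i _ => ?_
    rw [e]
    nlinarith [mul_nonneg (sq_nonneg (a i)) (sq_nonneg (Δ i))]
  have h3 : centralMass a x / (8 * n) ≤ V' := by
    rw [hV', centralMass, Finset.sum_div]
    refine Finset.sum_le_sum fun i _ => ?_
    split_ifs with h
    · rw [zero_div]
      exact mul_nonneg (sq_nonneg _) (mul_nonneg (hx'c i).1 (by linarith [(hx'c i).2]))
    · rw [div_eq_mul_one_div, e]
      gcongr
      exact le_mul_one_sub_of_margin hn (not_le.1 h) (abs_increment_le hn hx hU b i)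
  have hf := freezes_nonneg U x b
  have h4 : N' / n * V' ≤ N / n * (V + ∑ i, a i ^ 2 * (1 - 2 * x i) * Δ i)
      - freezes U x b / n * (centralMass a x / (8 * n)) := by
    have hV0 : 0 ≤ V' := (div_nonneg (centralMass_nonneg a x) (by positivity)).trans h3
    calc N' / n * V' ≤ (N - freezes U x b) / n * V' := by gcongr; linarith
      _ = N / n * V' - freezes U x b / n * V' := by ring
      _ ≤ _ := by gcongr
  have h5 : a ⬝ᵥ x' = a ⬝ᵥ x + a ⬝ᵥ Δ := by
    rw [hx', update_eq, dotProduct_add]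
  have h6 : slope a x ⬝ᵥ Δ = a ⬝ᵥ Δ + ∑ i, a i ^ 2 * weightSlope n (x i) * Δ i
      + 192 * (N / n * ∑ i, a i ^ 2 * (1 - 2 * x i) * Δ i) := by
    simp only [slope, dotProduct, Finset.mul_sum, ← Finset.sum_add_distrib]
    exact Finset.sum_congr rfl fun i _ => by ring
  have h7 : 24 / (n : ℝ) ^ 2 * centralMass a x * freezes U x b
      = 192 * (freezes U x b / n * (centralMass a x / (8 * n))) := by
    field_simp; ring
  rw [Finset.sum_sub_distrib, Finset.sum_add_distrib] at h1
  rw [h5, h6, potential, potential, compensation, h7, ← hV, ← hV', ← hN, ← hN', ← hΔ]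
  linarith

theorem abs_slope_dotProduct_increment_le {a : Fin n → ℝ} (ha : ∀ i, |a i| ≤ 1 / 500)
    (b : Fin n → Bool) : |slope a x ⬝ᵥ increment U x b| ≤ 1 := by
  have hn' : (0 : ℝ) < n := by exact_mod_cast hn
  calc |slope a x ⬝ᵥ increment U x b| ≤ ∑ i, |slope a x i * increment U x b i| :=
        Finset.abs_sum_le_sum_abs _ _
    _ ≤ ∑ _i : Fin n, 2 * (1 / 500) * (1 / (2 * (n : ℝ))) := by
        refine Finset.sum_le_sum fun i _ => ?_
        rw [abs_mul]
        gcongr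
        · exact (abs_slope_le hx ha i).trans (by linarith [ha i])
        · exact abs_increment_le hn hx hU b i
    _ ≤ 1 := by
        rw [Finset.sum_const, Finset.card_univ, Fintype.card_fin, nsmul_eq_mul]
        field_simp
        norm_num

theorem compensation_le {a : Fin n → ℝ} (ha : ∀ i, |a i| ≤ 1 / 500)
    (b : Fin n → Bool) : compensation a U x b ≤ 1 / 2 := by
  have hn' : (1 : ℝ) ≤ n := by exact_mod_cast hn
  have ha2 : ∀ i, a i ^ 2 ≤ (1 / 500) ^ 2 := fun i => by
    rw [← sq_abs]; gcongr; exact ha i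
  have h1 : ∑ i, a i ^ 2 * (weightCurvature n (x i) * increment U x b i ^ 2)
      ≤ ∑ _i : Fin n, (1 / 500 : ℝ) ^ 2 * (70 * n * (1 / (2 * n)) ^ 2) := by
    refine Finset.sum_le_sum fun i _ => ?_
    have h2 : increment U x b i ^ 2 ≤ (1 / (2 * n)) ^ 2 := by
      rw [← sq_abs]; gcongr; exact abs_increment_le hn hx hU b i
    refine mul_le_mul (ha2 i) ?_ (mul_nonneg (weightCurvature_nonneg _) (sq_nonneg _))
      (sq_nonneg _)
    gcongr
    exact weightCurvature_le hn _
  have h2 : centralMass a x ≤ ∑ _i : Fin n, (1 / 500 : ℝ) ^ 2 :=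
    Finset.sum_le_sum fun i _ => by
      split_ifs
      · positivity
      · exact ha2 i
  rw [Finset.sum_const, Finset.card_univ, Fintype.card_fin, nsmul_eq_mul] at h1 h2
  have h3 : 24 / (n : ℝ) ^ 2 * centralMass a x * freezes U x b
      ≤ 24 / (n : ℝ) ^ 2 * (n * (1 / 500) ^ 2) * 1 := by
    gcongr
    · exact freezes_nonneg U x b
    · exact freezes_le_one U x b
  have h4 : 24 / (n : ℝ) ^ 2 * (n * (1 / 500) ^ 2) * 1 ≤ 24 * (1 / 500) ^ 2 := by
    field_simp; norm_num; linarith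
  have h5 : (n : ℝ) * ((1 / 500) ^ 2 * (70 * n * (1 / (2 * n)) ^ 2)) = 70 / 4 * (1 / 500) ^ 2 := by
    field_simp; norm_num
  unfold compensation
  linarith

omit hn hx hU in
-- Cauchy–Schwarz over at most n coordinates; no property of the covariance is needed.
theorem sq_sum_near_le {a : Fin n → ℝ} (hx : x ∈ cube n) (ha : ∀ i, |a i| ≤ 1 / 500)
    (Δ : Fin n → ℝ) :
    ((fun i => if margin (x i) ≤ 1 / n then slope a x i else 0) ⬝ᵥ Δ) ^ 2 ≤
      ∑ i, a i ^ 2 * ((if margin (x i) ≤ 1 / n then 4 * (n : ℝ) else 0) * Δ i ^ 2) := by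
  have h := sq_sum_le_card_mul_sum_sq (s := Finset.univ)
    (f := fun i => (if margin (x i) ≤ 1 / n then slope a x i else 0) * Δ i)
  rw [Finset.card_univ, Fintype.card_fin] at h
  refine h.trans ?_
  rw [Finset.mul_sum]
  refine Finset.sum_le_sum fun i _ => ?_
  split_ifs
  · have h1 : slope a x i ^ 2 ≤ (2 * |a i|) ^ 2 := by
      rw [← sq_abs]; gcongr; exact abs_slope_le hx ha i
    rw [mul_pow, sq_abs] at h1
    calc (n : ℝ) * (slope a x i * Δ i) ^ 2 = n * Δ i ^ 2 * slope a x i ^ 2 := by ring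
      _ ≤ n * Δ i ^ 2 * (2 ^ 2 * a i ^ 2) := by gcongr
      _ = _ := by ring
  · simp

/-- Sub-isotropy with η = 20/9 and slopes at most `2 |a i|` give 80/9 for the variances and a
quarter of it, 20/9, for the loss by shortening. -/
theorem expect_sq_sum_central_le {a : Fin n → ℝ} (ha : ∀ i, |a i| ≤ 1 / 500) :
    𝔼 b, ((fun i => if margin (x i) ≤ 1 / n then 0 else slope a x i) ⬝ᵥ increment U x b) ^ 2 ≤
      ∑ i, a i ^ 2 * ((if margin (x i) ≤ 1 / n then 0 else 80 / 9) *
        𝔼 b, increment U x b i ^ 2) + 20 / 9 / n ^ 2 * centralMass a x * shortProb U x := by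
  have hn' : (0 : ℝ) < n := by exact_mod_cast hn
  refine (expect_dotProduct_increment_sq_le hn hx hU _).trans ?_
  rw [centralMass, Finset.mul_sum, Finset.mul_sum, Finset.sum_mul, ← Finset.sum_add_distrib]
  refine Finset.sum_le_sum fun i _ => ?_
  split_ifs
  · simp
  · have h1 : slope a x i ^ 2 ≤ (2 * |a i|) ^ 2 := by
      rw [← sq_abs]; gcongr; exact abs_slope_le hx ha i
    rw [mul_pow, sq_abs] at h1
    have h2 : 0 ≤ 𝔼 b, increment U x b i ^ 2 := Finset.expect_nonneg fun b _ => sq_nonneg _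
    have h3 := shortProb_nonneg U x
    calc 10 / (9 * slack) * (slope a x i ^ 2 *
          (𝔼 b, increment U x b i ^ 2 + shortProb U x / (4 * n ^ 2)))
        ≤ 10 / (9 * (1 / 2)) * ((2 ^ 2 * a i ^ 2) *
          (𝔼 b, increment U x b i ^ 2 + shortProb U x / (4 * n ^ 2))) := by
          unfold slack; gcongr
      _ = _ := by field_simp; ring

/-- The constants 48, 256 and 192 are chosen for this comparison. With the factor 2 from splitting
the square: 2 · 4n = 3/8 · 64n/3 near the ends, 2 · 80/9 ≤ 3/8 · 48 in the centre, and 2 · 20/9 · 2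
≤ 3/8 · 24 for freezing. -/
theorem expect_sq_slope_le {a : Fin n → ℝ} (ha : ∀ i, |a i| ≤ 1 / 500) :
    𝔼 b, (slope a x ⬝ᵥ increment U x b) ^ 2 ≤ 3 / 8 * 𝔼 b, compensation a U x b := by
  have hn' : (0 : ℝ) < n := by exact_mod_cast hn
  set near : Fin n → ℝ := fun i => if margin (x i) ≤ 1 / n then slope a x i else 0 with hnear
  set central : Fin n → ℝ := fun i => if margin (x i) ≤ 1 / n then 0 else slope a x i with hcentral
  have hsplit : slope a x = near + central := by
    ext i
    simp only [near, central, Pi.add_apply]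
    split_ifs <;> simp
  have h1 : 𝔼 b, (slope a x ⬝ᵥ increment U x b) ^ 2 ≤
      2 * 𝔼 b, (near ⬝ᵥ increment U x b) ^ 2 + 2 * 𝔼 b, (central ⬝ᵥ increment U x b) ^ 2 := by
    rw [Finset.mul_expect, Finset.mul_expect, ← Finset.expect_add_distrib]
    refine Finset.expect_le_expect fun b _ => ?_
    rw [hsplit, add_dotProduct]
    nlinarith [sq_nonneg (near ⬝ᵥ increment U x b - central ⬝ᵥ increment U x b)]
  have h2 : 𝔼 b, (near ⬝ᵥ increment U x b) ^ 2 ≤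
      ∑ i, a i ^ 2 * ((if margin (x i) ≤ 1 / n then 4 * (n : ℝ) else 0) *
        𝔼 b, increment U x b i ^ 2) := by
    calc 𝔼 b, (near ⬝ᵥ increment U x b) ^ 2
        ≤ 𝔼 b, ∑ i, a i ^ 2 * ((if margin (x i) ≤ 1 / n then 4 * (n : ℝ) else 0) *
            increment U x b i ^ 2) :=
          Finset.expect_le_expect fun b _ => sq_sum_near_le hx ha _
      _ = _ := by simp_rw [Finset.expect_sum_comm, ← Finset.mul_expect]
  have h3 := expect_sq_sum_central_le hn hx hU ha
  have h4 : 𝔼 b, compensation a U x b =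
      ∑ i, a i ^ 2 * (weightCurvature n (x i) * 𝔼 b, increment U x b i ^ 2) +
        24 / n ^ 2 * centralMass a x * 𝔼 b, freezes U x b := by
    simp only [compensation, Finset.expect_add_distrib]
    simp_rw [Finset.expect_sum_comm, ← Finset.mul_expect]
  have h5 := shortProb_le_expect_freezes hn hx hU
  have h6 : 2 * (20 / 9 / n ^ 2 * centralMass a x * shortProb U x)
      ≤ 3 / 8 * (24 / n ^ 2 * centralMass a x * 𝔼 b, freezes U x b) := by
    have h7 := mul_nonneg (by positivity : (0 : ℝ) ≤ 1 / n ^ 2) (centralMass_nonneg a x)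
    have h8 : 0 ≤ 𝔼 b, freezes U x b := Finset.expect_nonneg fun b _ => freezes_nonneg U x b
    calc 2 * (20 / 9 / n ^ 2 * centralMass a x * shortProb U x)
        = 40 / 9 * ((1 / n ^ 2 * centralMass a x) * shortProb U x) := by ring
      _ ≤ 40 / 9 * ((1 / n ^ 2 * centralMass a x) * (2 * 𝔼 b, freezes U x b)) := by gcongr
      _ ≤ 9 * ((1 / n ^ 2 * centralMass a x) * 𝔼 b, freezes U x b) := by
          nlinarith [mul_nonneg h7 h8]
      _ = _ := by ring
  have h9 : 2 * (∑ i, a i ^ 2 * ((if margin (x i) ≤ 1 / n then 4 * (n : ℝ) else 0) *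
        𝔼 b, increment U x b i ^ 2)) + 2 * (∑ i, a i ^ 2 *
        ((if margin (x i) ≤ 1 / n then 0 else 80 / 9) * 𝔼 b, increment U x b i ^ 2)) ≤
      3 / 8 * ∑ i, a i ^ 2 * (weightCurvature n (x i) * 𝔼 b, increment U x b i ^ 2) := by
    rw [Finset.mul_sum, Finset.mul_sum, Finset.mul_sum, ← Finset.sum_add_distrib]
    refine Finset.sum_le_sum fun i _ => ?_
    have h2 : 0 ≤ 𝔼 b, increment U x b i ^ 2 := Finset.expect_nonneg fun b _ => sq_nonneg _
    have h7 := mul_nonneg (sq_nonneg (a i)) h2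
    unfold weightCurvature
    split_ifs
    · nlinarith
    · nlinarith
  rw [h4]
  linarith

omit hn hx hU in
-- Multiply exp u ≤ 1 + u + u² by exp (-R) ≤ 1 - R/2 and use 1 + u + u² ≥ 3/4.
theorem exp_sub_le {u R : ℝ} (hu : |u| ≤ 1) (hR : 0 ≤ R) (hR' : R ≤ 1 / 2) :
    Real.exp (u - R) ≤ 1 + u + u ^ 2 - 3 / 8 * R := by
  have h1 := (abs_le.1 (Real.abs_exp_sub_one_sub_id_le hu)).2
  have h2 := (abs_le.1 (Real.abs_exp_sub_one_sub_id_le (x := -R)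
    (by rw [abs_neg, abs_of_nonneg hR]; linarith))).2
  have h3 : Real.exp (-R) ≤ 1 - R / 2 := by nlinarith
  rw [sub_eq_add_neg, Real.exp_add]
  calc Real.exp u * Real.exp (-R) ≤ (1 + u + u ^ 2) * (1 - R / 2) := by
        gcongr
        · nlinarith [sq_nonneg (1 + u / 2)]
        · linarith
    _ ≤ _ := by nlinarith [mul_nonneg hR (sq_nonneg (u + 1 / 2))]

/-- One step does not increase the exponential moment. -/
theorem expect_exp_update_le {a : Fin n → ℝ} (ha : ∀ i, |a i| ≤ 1 / 500) :
    𝔼 b, Real.exp (a ⬝ᵥ update U x (signs b) + potential a (update U x (signs b))) ≤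
      Real.exp (a ⬝ᵥ x + potential a x) := by
  calc 𝔼 b, Real.exp (a ⬝ᵥ update U x (signs b) + potential a (update U x (signs b)))
      ≤ 𝔼 b, Real.exp (a ⬝ᵥ x + potential a x) * (1 + slope a x ⬝ᵥ increment U x b +
          (slope a x ⬝ᵥ increment U x b) ^ 2 - 3 / 8 * compensation a U x b) := by
        refine Finset.expect_le_expect fun b _ => ?_
        refine (Real.exp_le_exp.2 (dotProduct_add_potential_update_le hn hx hU a b)).trans ?_
        rw [Real.exp_add]
        gcongr
        exact exp_sub_le (abs_slope_dotProduct_increment_le hn hx hU ha b)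
          (compensation_nonneg a U x b) (compensation_le hn hx hU ha b)
    _ = Real.exp (a ⬝ᵥ x + potential a x) * (1 + 0 +
          𝔼 b, (slope a x ⬝ᵥ increment U x b) ^ 2 - 3 / 8 * 𝔼 b, compensation a U x b) := by
        rw [← Finset.mul_expect, Finset.expect_sub_distrib, Finset.expect_add_distrib,
          Finset.expect_add_distrib, expect_dotProduct_increment, ← Finset.mul_expect]
        simp
    _ ≤ Real.exp (a ⬝ᵥ x + potential a x) * 1 := by
        gcongr
        linarith [expect_sq_slope_le hn hx hU ha]
    _ = _ := mul_one _

end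

/-! ### Existence of admissible covariance matrices -/

/-- The trace of a form is at least its trace on any subspace. -/
theorem mul_finrank_le_trace {ι : Type*} [Fintype ι] [DecidableEq ι] (H : Matrix ι ι ℝ)
    (hH : ∀ y, 0 ≤ y ⬝ᵥ H *ᵥ y) (P : Submodule ℝ (EuclideanSpace ℝ ι)) (η : ℝ)
    (hP : ∀ y ∈ P, η * (y.ofLp ⬝ᵥ y.ofLp) ≤ y.ofLp ⬝ᵥ H *ᵥ y.ofLp) :
    η * Module.finrank ℝ P ≤ H.trace := by
  classical
  set p := stdOrthonormalBasis ℝ P with hp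
  set v : Fin (Module.finrank ℝ P) → EuclideanSpace ℝ ι := fun i => (p i : EuclideanSpace ℝ ι)
    with hv
  have hon : Orthonormal ℝ v := p.orthonormal.comp_linearIsometry P.subtypeₗᵢ
  -- The trace may be computed in any orthonormal basis. In one that extends a basis of `P`, the
  -- additional vectors contribute nonnegative terms.
  obtain ⟨u, c, hu, hc⟩ := hon.toSubtypeRange.exists_orthonormalBasis_extension
  set T : EuclideanSpace ℝ ι →ₗ[ℝ] EuclideanSpace ℝ ι := Matrix.toEuclideanLin H with hT
  have hin : ∀ y : EuclideanSpace ℝ ι, inner ℝ y (T y) = y.ofLp ⬝ᵥ H *ᵥ y.ofLp := by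
    intro y
    rw [EuclideanSpace.inner_eq_star_dotProduct, dotProduct_comm]
    simp [hT]
  have h1 : H.trace = ∑ e : u, inner ℝ (e : EuclideanSpace ℝ ι) (T e) := by
    have h2 := LinearMap.trace_eq_sum_inner T c
    rw [LinearMap.trace_eq_sum_inner T (EuclideanSpace.basisFun ι ℝ)] at h2
    rw [hc] at h2
    rw [← h2, Matrix.trace]
    refine Finset.sum_congr rfl fun i _ => ?_
    rw [hin]
    simp
  rw [h1, Finset.sum_coe_sort u (fun e => inner ℝ e (T e))]
  have hsub : Finset.univ.image v ⊆ u := by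
    intro e he
    obtain ⟨i, -, rfl⟩ := Finset.mem_image.1 he
    exact hu ⟨i, rfl⟩
  calc η * Module.finrank ℝ P = ∑ i, η * (inner ℝ (v i) (v i) : ℝ) := by
        have h3 : ∀ i, (inner ℝ (v i) (v i) : ℝ) = 1 := fun i => by
          rw [real_inner_self_eq_norm_sq, hon.1 i, one_pow]
        simp only [h3, mul_one, Finset.sum_const, Finset.card_univ, Fintype.card_fin, nsmul_eq_mul]
        ring
    _ ≤ ∑ i, (inner ℝ (v i) (T (v i)) : ℝ) := by
        refine Finset.sum_le_sum fun i _ => ?_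
        rw [hin, EuclideanSpace.inner_eq_star_dotProduct]
        exact hP _ (p i).2
    _ = ∑ e ∈ Finset.univ.image v, (inner ℝ e (T e) : ℝ) := by
        rw [Finset.sum_image fun i _ j _ h => hon.linearIndependent.injective h]
    _ ≤ ∑ e ∈ u, (inner ℝ e (T e) : ℝ) :=
        Finset.sum_le_sum_of_subset_of_nonneg hsub fun e _ _ => by rw [hin]; exact hH _

/-- A form that dominates a multiple of its diagonal on a subspace of small codimension. -/
theorem mul_card_sub_finrank_le (T : Finset (Fin n)) (W : Submodule ℝ (Fin n → ℝ))
    (F : Matrix (Fin n) (Fin n) ℝ) (η : ℝ) (hη : 0 ≤ η) (hF : ∀ i, 0 < F i i)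
    (hF' : ∀ v, 0 ≤ v ⬝ᵥ F *ᵥ v)
    (hdom : ∀ v : Fin n → ℝ, (∀ i, i ∉ T → v i = 0) → (∀ w ∈ W, w ⬝ᵥ v = 0) →
      η * ∑ i, F i i * v i ^ 2 ≤ v ⬝ᵥ F *ᵥ v) :
    η * (T.card - Module.finrank ℝ W) ≤ T.card := by
  classical
  -- Rescaling by the inverse roots of the diagonal gives a form on `T` with unit diagonal, so of
  -- trace `T.card`, which is at least η on a subspace of codimension at most the dimension of `W`.
  set D : Matrix (Fin n) T ℝ := Matrix.of fun i j => if i = j then (√(F i i))⁻¹ else 0 with hD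
  have hDv : ∀ (y : T → ℝ) i, (D *ᵥ y) i = if h : i ∈ T then (√(F i i))⁻¹ * y ⟨i, h⟩ else 0 := by
    intro y i
    simp only [Matrix.mulVec, dotProduct, hD, Matrix.of_apply, ite_mul, zero_mul]
    split_ifs with h
    · rw [Finset.sum_eq_single ⟨i, h⟩]
      · simp
      · intro j _ hj
        exact if_neg fun h' => hj (Subtype.ext h'.symm)
      · simp
    · refine Finset.sum_eq_zero fun j _ => if_neg fun h' => h ?_
      rw [h']
      exact j.2
  set H : Matrix T T ℝ := Dᵀ * F * D with hH
  have hHq : ∀ y : T → ℝ, y ⬝ᵥ H *ᵥ y = (D *ᵥ y) ⬝ᵥ F *ᵥ (D *ᵥ y) := by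
    intro y
    rw [hH, ← Matrix.mulVec_mulVec, ← Matrix.mulVec_mulVec, Matrix.dotProduct_mulVec,
      ← Matrix.mulVec_transpose, Matrix.transpose_transpose]
  have hsq : ∀ i, √(F i i) * √(F i i) = F i i := fun i => Real.mul_self_sqrt (hF i).le
  have hpos : ∀ i, 0 < √(F i i) := fun i => Real.sqrt_pos.2 (hF i)
  have htr : H.trace = T.card := by
    have h1 : ∀ j : T, H j j = 1 := by
      intro j
      have h2 := hHq (Pi.single j 1)
      have h3 : D *ᵥ (Pi.single j 1) = Pi.single (j : Fin n) (√(F j j))⁻¹ := by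
        ext i
        rw [Matrix.mulVec_single_one]
        rcases eq_or_ne i j with rfl | h
        · simp [hD]
        · simp [hD, h]
      rw [h3] at h2
      simp only [Matrix.mulVec_single, Matrix.col_apply, single_dotProduct, Pi.smul_apply] at h2
      have h4 := hpos j
      simp only [MulOpposite.smul_eq_mul_unop, MulOpposite.unop_op, mul_one, one_mul] at h2
      rw [h2]
      nth_rewrite 2 [← hsq j]
      field_simp
    simp [Matrix.trace, h1]
  have hsum : ∀ y : T → ℝ, ∑ i, F i i * (D *ᵥ y) i ^ 2 = y ⬝ᵥ y := by
    intro y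
    rw [← Finset.sum_subset (Finset.subset_univ T) fun i _ hi => by rw [hDv, dif_neg hi]; ring,
      ← Finset.sum_coe_sort T, dotProduct]
    refine Finset.sum_congr rfl fun j _ => ?_
    rw [hDv, dif_pos j.2]
    have h4 := hpos j
    nth_rewrite 1 [← hsq j]
    field_simp
  set φ : EuclideanSpace ℝ T →ₗ[ℝ] Module.Dual ℝ W :=
    { toFun := fun y =>
        { toFun := fun w => (w : Fin n → ℝ) ⬝ᵥ D *ᵥ y.ofLp
          map_add' := fun w w' => by simp [add_dotProduct]
          map_smul' := fun r w => by simp [smul_dotProduct] }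
      map_add' := fun y y' => by ext w; simp [Matrix.mulVec_add, dotProduct_add]
      map_smul' := fun r y => by ext w; simp [Matrix.mulVec_smul, dotProduct_smul] } with hφ
  have hker : ∀ y ∈ LinearMap.ker φ, η * (y.ofLp ⬝ᵥ y.ofLp) ≤ y.ofLp ⬝ᵥ H *ᵥ y.ofLp := by
    intro y hy
    rw [hHq, ← hsum]
    refine hdom _ (fun i hi => by rw [hDv, dif_neg hi]) fun w hw => ?_
    have := LinearMap.congr_fun (LinearMap.mem_ker.1 hy) ⟨w, hw⟩
    simpa [hφ] using this
  have h1 := mul_finrank_le_trace H (fun y => by rw [hHq]; exact hF' _) (LinearMap.ker φ) η hker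
  have h2 := LinearMap.finrank_range_add_finrank_ker φ
  rw [finrank_euclideanSpace, Fintype.card_coe] at h2
  have h3 := Submodule.finrank_le (LinearMap.range φ)
  rw [Subspace.dual_finrank_eq] at h3
  rw [htr] at h1
  have h4 : (T.card : ℝ) - Module.finrank ℝ W ≤ Module.finrank ℝ (LinearMap.ker φ) := by
    rw [sub_le_iff_le_add']
    exact_mod_cast h2.symm.le.trans (Nat.add_le_add_right h3 _)
  exact (mul_le_mul_of_nonneg_left h4 hη).trans h1

theorem posSemidef_iff_real {U : Matrix (Fin n) (Fin n) ℝ} :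
    U.PosSemidef ↔ (∀ i j, U i j = U j i) ∧ ∀ v, 0 ≤ v ⬝ᵥ U *ᵥ v := by
  rw [Matrix.posSemidef_iff_dotProduct_mulVec]
  simp only [star_trivial]
  refine and_congr_left fun _ => ?_
  rw [Matrix.IsHermitian.ext_iff]
  simp only [star_trivial]
  exact forall_comm

/-- Test the form on the sum and the difference of two unit vectors. Used to bound all entries by
the trace, for compactness. -/
theorem two_mul_abs_le_of_posSemidef {U : Matrix (Fin n) (Fin n) ℝ} (hU : U.PosSemidef)
    (i j : Fin n) : 2 * |U i j| ≤ U i i + U j j := by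
  obtain ⟨h1, h2⟩ := posSemidef_iff_real.1 hU
  have h3 := h2 (Pi.single i 1 + Pi.single j 1)
  have h4 := h2 (Pi.single i 1 - Pi.single j 1)
  simp only [Matrix.mulVec_add, Matrix.mulVec_sub, Matrix.mulVec_single_one, add_dotProduct,
    sub_dotProduct, dotProduct_add, dotProduct_sub, single_dotProduct, Matrix.col_apply,
    one_mul] at h3 h4
  have := h1 i j
  rcases abs_cases (U i j) with h | h <;> linarith [h.1]

theorem apply_eq_zero_of_posSemidef {U : Matrix (Fin n) (Fin n) ℝ} (hU : U.PosSemidef)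
    {i : Fin n} (hi : U i i = 0) (j : Fin n) : U i j = 0 ∧ U j i = 0 := by
  have h : U *ᵥ Pi.single i 1 = 0 := by
    rw [← hU.dotProduct_mulVec_zero_iff]
    simp [hi]
  have h2 := congrFun h j
  rw [Matrix.mulVec_single_one, Matrix.col_apply, Pi.zero_apply] at h2
  exact ⟨by rw [(posSemidef_iff_real.1 hU).1, h2], h2⟩

/-! ### Admissibility as a convex feasibility problem, and its dual. -/

/-- The candidates for the covariance matrix, normalized by the trace. -/
def candidates (T : Finset (Fin n)) (W : Submodule ℝ (Fin n → ℝ)) (τ : ℝ) :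
    Set (Matrix (Fin n) (Fin n) ℝ) :=
  {U | U.PosSemidef ∧ U.trace = τ ∧ (∀ i, i ∉ T → U i i = 0) ∧ ∀ w ∈ W, w ⬝ᵥ U *ᵥ w = 0}

theorem isClosed_posSemidef : IsClosed {U : Matrix (Fin n) (Fin n) ℝ | U.PosSemidef} := by
  simp only [posSemidef_iff_real, Set.ofPred_and, Set.ofPred_forall]
  refine IsClosed.inter ?_ ?_
  · exact isClosed_iInter fun i => isClosed_iInter fun j => isClosed_eq (by fun_prop) (by fun_prop)
  · exact isClosed_iInter fun v => isClosed_le (by fun_prop) (by fun_prop)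

theorem isCompact_candidates (T : Finset (Fin n)) (W : Submodule ℝ (Fin n → ℝ)) (τ : ℝ) :
    IsCompact (candidates T W τ) := by
  have hK : IsCompact (Set.univ.pi fun _ => Set.univ.pi fun _ => Set.Icc (-τ) τ :
      Set (Fin n → Fin n → ℝ)) :=
    isCompact_univ_pi fun _ => isCompact_univ_pi fun _ => isCompact_Icc
  refine hK.of_isClosed_subset (t := candidates T W τ) ?_ ?_
  · simp only [candidates, Set.ofPred_and, Set.ofPred_forall]
    refine isClosed_posSemidef.inter (IsClosed.inter ?_ (IsClosed.inter ?_ ?_))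
    · exact isClosed_eq (by fun_prop) continuous_const
    · exact isClosed_iInter fun i => isClosed_iInter fun _ =>
        isClosed_eq (by fun_prop) continuous_const
    · exact isClosed_iInter fun w => isClosed_iInter fun _ =>
        isClosed_eq (by fun_prop) continuous_const
  · rintro U ⟨h1, h2, -⟩ i - j -
    have h3 : ∀ i, U i i ≤ τ := fun i => by
      rw [← h2]
      exact Finset.single_le_sum (f := fun i => U i i) (fun i _ => h1.diag_nonneg)
        (Finset.mem_univ i)
    rw [Set.mem_Icc, ← abs_le]
    linarith [two_mul_abs_le_of_posSemidef h1 i j, h3 i, h3 j]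

theorem convex_posSemidef : Convex ℝ {U : Matrix (Fin n) (Fin n) ℝ | U.PosSemidef} :=
  fun _ h _ h' _ _ hs ht _ => (h.smul hs).add (h'.smul ht)

theorem convex_candidates (T : Finset (Fin n)) (W : Submodule ℝ (Fin n → ℝ)) (τ : ℝ) :
    Convex ℝ (candidates T W τ) := by
  rintro U ⟨h1, h2, h3, h4⟩ V ⟨k1, k2, k3, k4⟩ s t hs ht hst
  refine ⟨convex_posSemidef h1 k1 hs ht hst, ?_, fun i hi => ?_, fun w hw => ?_⟩
  · rw [Matrix.trace_add, Matrix.trace_smul, Matrix.trace_smul, h2, k2, smul_eq_mul, smul_eq_mul,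
      ← add_mul, hst, one_mul]
  · simp [h3 i hi, k3 i hi]
  · rw [Matrix.add_mulVec, Matrix.smul_mulVec, Matrix.smul_mulVec, dotProduct_add,
      dotProduct_smul, dotProduct_smul, h4 w hw, k4 w hw]
    simp

/-- The slacks of the constraints on a candidate of trace `τ`. -/
def constraintMap (n : ℕ) (τ η : ℝ) :
    Matrix (Fin n) (Fin n) ℝ →ₗ[ℝ] (Fin n → ℝ) × (Fin n → Fin n → ℝ) where
  -- On candidates `U.trace / τ` is 1; writing it this way makes the map linear.
  toFun U := (fun i => U.trace / τ - U i i, η • Matrix.diagonal (fun i => U i i) - U)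
  map_add' U V := by
    refine Prod.ext ?_ ?_
    · ext i
      simp only [Matrix.trace_add, Matrix.add_apply, Prod.fst_add, Pi.add_apply]
      ring
    · ext i j
      change η • Matrix.diagonal (fun i => (U + V) i i) i j - (U + V) i j
        = (η • Matrix.diagonal (fun i => U i i) i j - U i j)
          + (η • Matrix.diagonal (fun i => V i i) i j - V i j)
      simp only [Matrix.diagonal_apply, Matrix.add_apply, smul_eq_mul]
      split_ifs <;> ring
  map_smul' r U := by
    refine Prod.ext ?_ ?_
    · ext i
      simp only [Matrix.trace_smul, Matrix.smul_apply, Prod.smul_fst, Pi.smul_apply, smul_eq_mul,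
        RingHom.id_apply]
      ring
    · ext i j
      change η • Matrix.diagonal (fun i => (r • U) i i) i j - (r • U) i j
        = r * (η • Matrix.diagonal (fun i => U i i) i j - U i j)
      simp only [Matrix.diagonal_apply, Matrix.smul_apply, smul_eq_mul]
      split_ifs <;> ring

/-- The pairs of a nonnegative vector and a positive semidefinite matrix. -/
def slackCone (n : ℕ) : Set ((Fin n → ℝ) × (Fin n → Fin n → ℝ)) :=
  {z | (∀ i, 0 ≤ z.1 i) ∧ (Matrix.of z.2).PosSemidef}

theorem convex_slackCone : Convex ℝ (slackCone n) := by
  rintro y ⟨h1, h2⟩ z ⟨k1, k2⟩ s t hs ht hst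
  refine ⟨fun i => ?_, ?_⟩
  · exact add_nonneg (mul_nonneg hs (h1 i)) (mul_nonneg ht (k1 i))
  · exact convex_posSemidef h2 k2 hs ht hst

theorem isClosed_slackCone : IsClosed (slackCone n) := by
  simp only [slackCone, Set.ofPred_and, Set.ofPred_forall]
  refine IsClosed.inter ?_ ?_
  · exact isClosed_iInter fun i => isClosed_le continuous_const (by fun_prop)
  · exact (isClosed_posSemidef (n := n)).preimage (f := fun z :
      (Fin n → ℝ) × (Fin n → Fin n → ℝ) => (Matrix.of z.2 : Matrix (Fin n) (Fin n) ℝ))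
      continuous_snd

/-- A dual certificate for the absence of candidates that satisfy the constraints. -/
theorem exists_dual_of_disjoint {T : Finset (Fin n)} {W : Submodule ℝ (Fin n → ℝ)} {τ η : ℝ}
    (hdisj : Disjoint (constraintMap n τ η '' candidates T W τ) (slackCone n)) :
    ∃ (β : Fin n → ℝ) (F : Matrix (Fin n) (Fin n) ℝ) (u : ℝ), u < 0 ∧ (∀ i, 0 ≤ β i) ∧
      (∀ v, 0 ≤ v ⬝ᵥ F *ᵥ v) ∧
      ∀ U ∈ candidates T W τ, ∑ i, β i * (U.trace / τ - U i i) +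
        (η * ∑ i, F i i * U i i - ∑ i, ∑ j, F i j * U i j) < u := by
  obtain ⟨f, u, v, hf, huv, hf'⟩ := geometric_hahn_banach_compact_closed
    ((convex_candidates T W τ).linear_image (constraintMap n τ η))
    ((isCompact_candidates T W τ).image (LinearMap.continuous_of_finiteDimensional _))
    convex_slackCone isClosed_slackCone hdisj
  have hv : v < 0 := by
    have := hf' 0 ⟨fun i => le_rfl, Matrix.PosSemidef.zero⟩
    simpa using this
  -- A linear functional bounded below on a cone is nonnegative there.
  have hcone : ∀ z ∈ slackCone n, 0 ≤ f z := by
    intro z hz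
    by_contra! hneg
    have hl : 0 < v / f z := div_pos_of_neg_of_neg hv hneg
    have := hf' ((v / f z) • z) ⟨fun i => mul_nonneg hl.le (hz.1 i), hz.2.smul hl.le⟩
    rw [map_smul, smul_eq_mul, div_mul_cancel₀ _ hneg.ne] at this
    exact lt_irrefl _ this
  set β : Fin n → ℝ := fun i => f (Pi.single i 1, 0) with hβ
  set F : Matrix (Fin n) (Fin n) ℝ := fun i j => f (0, Pi.single i (Pi.single j 1)) with hF
  have hfz : ∀ z, f z = ∑ i, β i * z.1 i + ∑ i, ∑ j, F i j * z.2 i j := by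
    intro z
    have h1 : z = ∑ i, z.1 i • ((Pi.single i 1, 0) : (Fin n → ℝ) × (Fin n → Fin n → ℝ))
        + ∑ i, ∑ j, z.2 i j •
          ((0, Pi.single i (Pi.single j 1)) : (Fin n → ℝ) × (Fin n → Fin n → ℝ)) := by
      refine Prod.ext ?_ ?_
      · ext k
        simp [Prod.fst_sum, Finset.sum_apply, Pi.single_apply]
      · ext k l
        simp only [Prod.snd_add, Prod.snd_sum, Prod.smul_mk, smul_zero, Finset.sum_const_zero,
          zero_add, Finset.sum_apply, Pi.smul_apply, smul_eq_mul]
        rw [Finset.sum_eq_single k, Finset.sum_eq_single l]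
        · simp
        · intro j _ hj; simp [hj.symm]
        · simp
        · intro i _ hi; simp [hi.symm]
        · simp
    conv_lhs => rw [h1]
    simp only [map_add, map_sum, map_smul, smul_eq_mul]
    congr 1
    · exact Finset.sum_congr rfl fun i _ => mul_comm _ _
    · exact Finset.sum_congr rfl fun i _ => Finset.sum_congr rfl fun j _ => mul_comm _ _
  refine ⟨β, F, u, huv.trans hv, fun i => hcone _ ⟨fun j => ?_, Matrix.PosSemidef.zero⟩,
    fun x => ?_, fun U hU => ?_⟩
  · change 0 ≤ (Pi.single i 1 : Fin n → ℝ) j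
    rw [Pi.single_apply]
    split_ifs <;> norm_num
  · have h1 := hcone (0, Matrix.vecMulVec x x) ⟨fun i => le_rfl, by
      have := Matrix.posSemidef_vecMulVec_self_star x
      rw [star_trivial] at this
      exact this⟩
    rw [hfz] at h1
    refine h1.trans_eq ?_
    simp only [Pi.zero_apply, mul_zero, Finset.sum_const_zero, zero_add, dotProduct,
      Matrix.mulVec, Finset.mul_sum, Matrix.vecMulVec_apply]
    exact Finset.sum_congr rfl fun i _ => Finset.sum_congr rfl fun j _ => by ring
  · have h1 := hf _ ⟨U, hU, rfl⟩
    rw [hfz] at h1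
    refine lt_of_eq_of_lt ?_ h1
    have h2 : ∀ i j, (constraintMap n τ η U).2 i j
        = η * (if i = j then U i i else 0) - U i j := fun i j => rfl
    have h3 : η * ∑ i, F i i * U i i = ∑ i, ∑ j, F i j * (η * if i = j then U i i else 0) := by
      rw [Finset.mul_sum]
      refine Finset.sum_congr rfl fun i _ => ?_
      simp only [mul_ite, mul_zero, Finset.sum_ite_eq, Finset.mem_univ, if_true]
      ring
    refine congrArg₂ (· + ·) rfl ?_
    simp only [h2, h3, mul_sub, Finset.sum_sub_distrib]

/-- The candidate of rank one. -/
theorem vecMulVec_mem_candidates {T : Finset (Fin n)} {W : Submodule ℝ (Fin n → ℝ)}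
    {v : Fin n → ℝ} (hv : ∀ i, i ∉ T → v i = 0) (hv' : ∀ w ∈ W, w ⬝ᵥ v = 0) :
    Matrix.vecMulVec v v ∈ candidates T W (∑ i, v i ^ 2) := by
  refine ⟨?_, ?_, fun i hi => ?_, fun w hw => ?_⟩
  · have := Matrix.posSemidef_vecMulVec_self_star v
    simpa using this
  · simp [Matrix.trace, Matrix.vecMulVec_apply, sq]
  · simp [Matrix.vecMulVec_apply, hv i hi]
  · rw [Matrix.vecMulVec_mulVec, dotProduct_smul, hv' w hw, smul_zero]

theorem exists_mem_candidates {T : Finset (Fin n)} (hT : 0 < T.card)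
    (W : Submodule ℝ (Fin n → ℝ)) (hW : 2 * Module.finrank ℝ W ≤ T.card) :
    ∃ U ∈ candidates T W (T.card / 20),
      constraintMap n (T.card / 20) (20 / 9) U ∈ slackCone n := by
  have hN : (0 : ℝ) < T.card := by exact_mod_cast hT
  set τ : ℝ := T.card / 20 with hτ
  have hτ0 : 0 < τ := by positivity
  by_contra! hcon
  obtain ⟨β, F, u, hu, hβ, hF, hU⟩ := exists_dual_of_disjoint (T := T) (W := W) (τ := τ)
    (η := 20 / 9) (by
      rw [Set.disjoint_left]
      rintro _ ⟨U, hU, rfl⟩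
      exact hcon U hU)
  -- The certificate is evaluated on rank-one candidates, scaled to trace `τ`.
  have hv : ∀ v : Fin n → ℝ, (∀ i, i ∉ T → v i = 0) → (∀ w ∈ W, w ⬝ᵥ v = 0) →
      ∑ i, β i * ((∑ j, v j ^ 2) / τ - v i ^ 2) + (20 / 9 * ∑ i, F i i * v i ^ 2 - v ⬝ᵥ F *ᵥ v)
        ≤ u * ((∑ j, v j ^ 2) / τ) := by
    intro v hv hv'
    set q := ∑ j, v j ^ 2 with hq
    have hq0 : 0 ≤ q := Finset.sum_nonneg fun j _ => sq_nonneg (v j)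
    rcases hq0.eq_or_lt with h0 | h0
    · have h1 : ∀ i, v i = 0 := fun i => by
        have := (Finset.sum_eq_zero_iff_of_nonneg fun j _ => sq_nonneg (v j)).1 h0.symm i
          (Finset.mem_univ i)
        simpa using this
      have h2 : v = 0 := funext h1
      rw [← h0, h2]
      simp
    · set r := √(τ / q) with hr
      have hr2 : r ^ 2 = τ / q := Real.sq_sqrt (by positivity)
      have h1 := vecMulVec_mem_candidates (T := T) (W := W) (v := r • v)
        (fun i hi => by simp [hv i hi]) fun w hw => by rw [dotProduct_smul, hv' w hw, smul_zero]
      have h2 : ∑ i, (r • v) i ^ 2 = τ := by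
        simp only [Pi.smul_apply, smul_eq_mul, mul_pow, ← Finset.mul_sum, ← hq, hr2]
        field_simp
      rw [h2] at h1
      have h3 := hU _ h1
      rw [h1.2.1] at h3
      have h4 : ∀ i j, Matrix.vecMulVec (r • v) (r • v) i j = (τ / q) * (v i * v j) := by
        intro i j
        rw [Matrix.vecMulVec_apply, ← hr2]
        simp only [Pi.smul_apply, smul_eq_mul]
        ring
      simp only [h4] at h3
      have h5 : ∑ i, β i * (q / τ - v i ^ 2) + (20 / 9 * ∑ i, F i i * v i ^ 2 - v ⬝ᵥ F *ᵥ v)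
          = (q / τ) * (∑ i, β i * (τ / τ - τ / q * (v i * v i)) +
            (20 / 9 * ∑ i, F i i * (τ / q * (v i * v i))
              - ∑ i, ∑ j, F i j * (τ / q * (v i * v j)))) := by
        simp only [dotProduct, Matrix.mulVec, mul_add, mul_sub, Finset.mul_sum]
        congr 1
        · refine Finset.sum_congr rfl fun i _ => ?_
          field_simp
        · congr 1
          · refine Finset.sum_congr rfl fun i _ => ?_
            field_simp
          · refine Finset.sum_congr rfl fun i _ => Finset.sum_congr rfl fun j _ => ?_
            field_simp
      rw [h5, mul_comm u]
      exact mul_le_mul_of_nonneg_left h3.le (by positivity)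
  -- The strict gap `u < 0` leaves room to add a multiple of the identity to `F`, which makes its
  -- diagonal positive.
  set ε := -u / (20 / 9 * τ) with hε
  have hε0 : 0 < ε := div_pos (by linarith) (by positivity)
  set s := (∑ i, β i) / τ with hs
  have hs0 : 0 ≤ s := div_nonneg (Finset.sum_nonneg fun i _ => hβ i) hτ0.le
  -- Where `β i` is at most `s`, the multipliers of the diagonal constraints help and can be
  -- dropped. By Markov's inequality fewer than `τ` coordinates are lost.
  set T₀ := T.filter fun i => β i ≤ s with hT₀
  have h1 := mul_card_sub_finrank_le T₀ W (F + ε • 1) (20 / 9) (by norm_num)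
    (fun i => by
      have := hF (Pi.single i 1)
      rw [single_dotProduct_mulVec_single] at this
      simpa using by linarith)
    (fun v => by
      rw [Matrix.add_mulVec, Matrix.smul_mulVec, Matrix.one_mulVec, dotProduct_add,
        dotProduct_smul]
      exact add_nonneg (hF v) (mul_nonneg hε0.le (by
        simpa [dotProduct] using Finset.sum_nonneg fun i _ => mul_self_nonneg (v i))))
    (fun v hv0 hv1 => by
      have k1 := hv v (fun i hi => hv0 i fun h => hi (Finset.mem_filter.1 h).1) hv1
      set q := ∑ j, v j ^ 2 with hq
      have hq0 : 0 ≤ q := Finset.sum_nonneg fun j _ => sq_nonneg (v j)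
      have k2 : ∑ i, β i * v i ^ 2 ≤ s * q := by
        rw [hq, Finset.mul_sum]
        refine Finset.sum_le_sum fun i _ => ?_
        by_cases hi : i ∈ T₀
        · exact mul_le_mul_of_nonneg_right (Finset.mem_filter.1 hi).2 (sq_nonneg _)
        · simp [hv0 i hi]
      have k3 : ∑ i, β i * (q / τ - v i ^ 2) = s * q - ∑ i, β i * v i ^ 2 := by
        simp only [mul_sub, Finset.sum_sub_distrib, ← Finset.sum_mul, hs]
        ring
      have k4 : v ⬝ᵥ (F + ε • 1) *ᵥ v = v ⬝ᵥ F *ᵥ v + ε * q := by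
        rw [Matrix.add_mulVec, Matrix.smul_mulVec, Matrix.one_mulVec, dotProduct_add,
          dotProduct_smul, smul_eq_mul]
        simp [hq, dotProduct, sq]
      have k5 : ∑ i, (F + ε • (1 : Matrix (Fin n) (Fin n) ℝ)) i i * v i ^ 2
          = ∑ i, F i i * v i ^ 2 + ε * q := by
        rw [hq, Finset.mul_sum, ← Finset.sum_add_distrib]
        refine Finset.sum_congr rfl fun i _ => ?_
        simp
        ring
      have k6 : 20 / 9 * (ε * q) = -(u * (q / τ)) := by
        rw [hε]; field_simp
      have k7 : 0 ≤ ε * q := mul_nonneg hε0.le hq0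
      rw [k4, k5]
      linarith)
  have h2 : ((T.card : ℝ) - T₀.card) < τ := by
    have e : (T.card : ℝ) - T₀.card = (T.filter fun i => ¬ β i ≤ s).card := by
      rw [sub_eq_iff_eq_add', hT₀]
      exact_mod_cast (Finset.card_filter_add_card_filter_not fun i => β i ≤ s).symm
    rw [e]
    rcases (T.filter fun i => ¬ β i ≤ s).eq_empty_or_nonempty with h | h
    · rw [h]; simpa using hτ0
    · have k1 : ((T.filter fun i => ¬ β i ≤ s).card : ℝ) * s <
          ∑ i ∈ T.filter fun i => ¬ β i ≤ s, β i := by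
        rw [← nsmul_eq_mul, ← Finset.sum_const]
        exact Finset.sum_lt_sum_of_nonempty h fun i hi => not_le.1 (Finset.mem_filter.1 hi).2
      have k2 : ∑ i ∈ T.filter fun i => ¬ β i ≤ s, β i ≤ ∑ i, β i :=
        Finset.sum_le_sum_of_subset_of_nonneg (Finset.subset_univ _) fun i _ _ => hβ i
      have k3 : ∑ i, β i = τ * s := by rw [hs]; field_simp
      rw [k3] at k2
      exact lt_of_mul_lt_mul_right (k1.trans_le k2) hs0
  -- With N = `T.card`, `h1` now forces |T₀| ≤ 10N/11, whereas `h2` says |T₀| > 19N/20.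
  have h3 : (2 : ℝ) * Module.finrank ℝ W ≤ T.card := by exact_mod_cast hW
  rw [hτ] at h2
  linarith

/-! ### Counting big rows. -/

theorem sum_sq_le_maxColNorm_sq (A : Matrix (Fin m) (Fin n) ℝ) (j : Fin n) :
    ∑ i, A i j ^ 2 ≤ maxColNorm A ^ 2 := by
  have h1 : √(∑ i, A i j ^ 2) ≤ maxColNorm A :=
    le_ciSup (f := fun j => √(∑ i, A i j ^ 2)) (Set.finite_range _).bddAbove j
  have h0 : 0 ≤ ∑ i, A i j ^ 2 := Finset.sum_nonneg fun i _ => sq_nonneg _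
  rw [← Real.sq_sqrt h0]
  gcongr

open Classical in
-- Double counting of squared entries: every big row has more than 2t₂² on the alive columns, every
-- column at most t₂².
theorem two_mul_card_isBigRow_le (A : Matrix (Fin m) (Fin n) ℝ) (x : Fin n → ℝ) :
    2 * (Finset.univ.filter (IsBigRow A x)).card ≤ (alive x).card := by
  set B := Finset.univ.filter (IsBigRow A x) with hB
  rcases B.eq_empty_or_nonempty with h | h
  · simp [h]
  have h1 : (B.card : ℝ) * (2 * maxColNorm A ^ 2) < ∑ i ∈ B, ∑ j ∈ alive x, A i j ^ 2 := by
    rw [← nsmul_eq_mul, ← Finset.sum_const]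
    exact Finset.sum_lt_sum_of_nonempty h fun i hi => (Finset.mem_filter.1 hi).2
  have h2 : ∑ i ∈ B, ∑ j ∈ alive x, A i j ^ 2 ≤ (alive x).card * maxColNorm A ^ 2 := by
    rw [Finset.sum_comm, ← nsmul_eq_mul, ← Finset.sum_const]
    refine Finset.sum_le_sum fun j _ => le_trans ?_ (sum_sq_le_maxColNorm_sq A j)
    exact Finset.sum_le_sum_of_subset_of_nonneg (Finset.subset_univ _) fun i _ _ => sq_nonneg _
  have h3 : (2 * B.card : ℝ) * maxColNorm A ^ 2 < (alive x).card * maxColNorm A ^ 2 := by linarith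
  have h4 := lt_of_mul_lt_mul_right h3 (sq_nonneg _)
  exact_mod_cast h4.le

theorem two_mul_finrank_protectedSpace_le (A : Matrix (Fin m) (Fin n) ℝ) (x : Fin n → ℝ) :
    2 * Module.finrank ℝ (protectedSpace A x) ≤ (alive x).card := by
  classical
  refine le_trans (Nat.mul_le_mul_left 2 ?_) (two_mul_card_isBigRow_le A x)
  have h : {w : Fin n → ℝ | ∃ i, IsBigRow A x i ∧ w = fun j => if j ∈ alive x then A i j else 0}
      = (((Finset.univ.filter (IsBigRow A x)).image
        fun i j => if j ∈ alive x then A i j else 0 : Finset (Fin n → ℝ)) : Set (Fin n → ℝ)) := by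
    ext w
    simp only [Finset.coe_image, Finset.coe_filter, Finset.mem_univ, true_and]
    exact ⟨fun ⟨i, h1, h2⟩ => ⟨i, h1, h2.symm⟩, fun ⟨i, h1, h2⟩ => ⟨i, h1, h2.symm⟩⟩
  rw [protectedSpace, h]
  exact (finrank_span_finset_le_card _).trans Finset.card_image_le

theorem exists_isUpdateCovariance (A : Matrix (Fin m) (Fin n) ℝ) (x : Fin n → ℝ) :
    ∃ U, IsUpdateCovariance A x U := by
  have hη : (10 / (9 * slack) : ℝ) = 20 / 9 := by norm_num [slack]
  rcases Nat.eq_zero_or_pos (alive x).card with h0 | h0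
  · refine ⟨0, Matrix.PosSemidef.zero, by simp, by simp, by simp, by simp [h0], ?_⟩
    have : (10 / (9 * slack)) • Matrix.diagonal (fun i => (0 : Matrix (Fin n) (Fin n) ℝ) i i)
        - 0 = 0 := by
      ext i j
      simp
    rw [this]
    exact Matrix.PosSemidef.zero
  · have hN : (0 : ℝ) < (alive x).card := by exact_mod_cast h0
    obtain ⟨U, ⟨h1, h2, h3, h4⟩, h5, h6⟩ := exists_mem_candidates h0 (protectedSpace A x)
      (two_mul_finrank_protectedSpace_le A x)
    refine ⟨U, h1, fun i hi j => apply_eq_zero_of_posSemidef h1 (h3 i hi) j, h4, fun i => ?_, ?_,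
      ?_⟩
    · have h7 : 0 ≤ U.trace / ((alive x).card / 20) - U i i := h5 i
      rw [h2, div_self (by positivity)] at h7
      linarith
    · rw [h2, slack]
      linarith
    · rw [hη]
      exact h6

/-! ### The law of the iterates -/

/-- The expectation of a function of the next point. -/
def stepAvg (rule : (Fin n → ℝ) → Matrix (Fin n) (Fin n) ℝ) (F : (Fin n → ℝ) → ℝ)
    (x : Fin n → ℝ) : ℝ :=
  𝔼 b, F (update (rule x) x (signs b))

theorem iterate_congr (rule : (Fin n → ℝ) → Matrix (Fin n) (Fin n) ℝ) (x : Fin n → ℝ)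
    {ω ω' : Coins n} {k : ℕ} (h : ∀ j < k, ω j = ω' j) :
    iterate rule x ω k = iterate rule x ω' k := by
  induction k with
  | zero => rfl
  | succ k ih =>
    rw [iterate, iterate, ih fun j hj => h j (hj.trans (Nat.lt_succ_self k)),
      h k (Nat.lt_succ_self k)]

/-- The point after `k` iterations, as a function of the first `k` rounds of coins. -/
def iterateOfFinite (rule : (Fin n → ℝ) → Matrix (Fin n) (Fin n) ℝ) (x : Fin n → ℝ) (k : ℕ)
    (z : Finset.range k → Fin n → Bool) : Fin n → ℝ :=
  iterate rule x (fun j => if h : j ∈ Finset.range k then z ⟨j, h⟩ else fun _ => false) k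

theorem iterate_eq_iterateOfFinite (rule : (Fin n → ℝ) → Matrix (Fin n) (Fin n) ℝ)
    (x : Fin n → ℝ) (k : ℕ) (ω : Coins n) :
    iterate rule x ω k = iterateOfFinite rule x k (fun j => ω j) := by
  refine iterate_congr rule x fun j hj => ?_
  rw [dif_pos (Finset.mem_range.2 hj)]

/-- The point depends on finitely many coins only, so neither the rule nor `F` has to be measurable.
-/
theorem measurable_comp_iterate (rule : (Fin n → ℝ) → Matrix (Fin n) (Fin n) ℝ) (x : Fin n → ℝ)
    (k : ℕ) {β : Type*} [MeasurableSpace β] (F : (Fin n → ℝ) → β) :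
    Measurable fun ω => F (iterate rule x ω k) := by
  simp only [iterate_eq_iterateOfFinite]
  exact (Measurable.of_discrete (f := F ∘ iterateOfFinite rule x k)).comp (by fun_prop)

instance : IsProbabilityMeasure (coinMeasure n) := by
  unfold coinMeasure
  infer_instance

theorem integrable_comp_iterate (rule : (Fin n → ℝ) → Matrix (Fin n) (Fin n) ℝ) (x : Fin n → ℝ)
    (k : ℕ) (F : (Fin n → ℝ) → ℝ) :
    Integrable (fun ω => F (iterate rule x ω k)) (coinMeasure n) := by
  obtain ⟨C, hC⟩ := (Set.finite_range fun z => ‖F (iterateOfFinite rule x k z)‖).bddAbove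
  refine Integrable.of_bound (measurable_comp_iterate rule x k F).aestronglyMeasurable C
    (Filter.Eventually.of_forall fun ω => ?_)
  rw [iterate_eq_iterateOfFinite]
  exact hC ⟨_, rfl⟩

theorem integral_pi_uniform (h : (Fin n → Bool) → ℝ) :
    ∫ b, h b ∂(Measure.pi fun _ : Fin n => (PMF.uniformOfFintype Bool).toMeasure) = 𝔼 b, h b := by
  rw [integral_fintype Integrable.of_finite, Finset.expect_eq_sum_div_card, Finset.sum_div]
  refine Finset.sum_congr rfl fun b _ => ?_
  have : (Measure.pi fun _ : Fin n => (PMF.uniformOfFintype Bool).toMeasure).real {b}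
      = (1 / 2 : ℝ) ^ n := by
    rw [Measure.real, Measure.pi_singleton, ENNReal.toReal_prod]
    simp
  rw [this, smul_eq_mul, Finset.card_univ, Fintype.card_fun, Fintype.card_bool, Fintype.card_fin]
  push_cast
  rw [one_div, inv_pow]
  field_simp

/-- The Markov property: round `k` is independent of the rounds before it. Expectations thus become
powers of the operator `stepAvg`. -/
theorem integral_iterate_succ (rule : (Fin n → ℝ) → Matrix (Fin n) (Fin n) ℝ) (x : Fin n → ℝ)
    (k : ℕ) (F : (Fin n → ℝ) → ℝ) :
    ∫ ω, F (iterate rule x ω (k + 1)) ∂coinMeasure n =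
      ∫ ω, stepAvg rule F (iterate rule x ω k) ∂coinMeasure n := by
  set μ := Measure.pi fun _ : Fin n => (PMF.uniformOfFintype Bool).toMeasure with hμ
  set X : Coins n → Finset.range k → Fin n → Bool := fun ω j => ω j with hX
  set Y : Coins n → Fin n → Bool := fun ω => ω k with hY
  have hXm : Measurable X := by fun_prop
  have hYm : Measurable Y := by fun_prop
  have hind : ProbabilityTheory.IndepFun X Y (coinMeasure n) := by
    have h1 := ProbabilityTheory.iIndepFun_infinitePi (P := fun _ : ℕ => μ)
      (X := fun _ (b : Fin n → Bool) => b) (fun _ => measurable_id)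
    have h2 := h1.indepFun_finset (Finset.range k) {k} (by simp) fun i => by fun_prop
    exact h2.comp (φ := id) (ψ := fun z : ({k} : Finset ℕ) → Fin n → Bool =>
      z ⟨k, Finset.mem_singleton_self k⟩) measurable_id (by fun_prop)
  have hYmap : (coinMeasure n).map Y = μ := Measure.infinitePi_map_eval _ k
  have hprod := (ProbabilityTheory.indepFun_iff_map_prod_eq_prod_map_map hXm.aemeasurable
    hYm.aemeasurable).1 hind
  set G : (Finset.range k → Fin n → Bool) × (Fin n → Bool) → ℝ := fun p =>
    F (update (rule (iterateOfFinite rule x k p.1)) (iterateOfFinite rule x k p.1) (signs p.2))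
    with hG
  have : IsProbabilityMeasure ((coinMeasure n).map X) :=
    Measure.isProbabilityMeasure_map hXm.aemeasurable
  calc ∫ ω, F (iterate rule x ω (k + 1)) ∂coinMeasure n = ∫ ω, G (X ω, Y ω) ∂coinMeasure n := by
        simp only [iterate, hG, hX, hY, iterate_eq_iterateOfFinite rule x k]
    _ = ∫ p, G p ∂((coinMeasure n).map fun ω => (X ω, Y ω)) :=
        (integral_map (hXm.prodMk hYm).aemeasurable
          Measurable.of_discrete.aestronglyMeasurable).symm
    _ = ∫ z, ∫ b, G (z, b) ∂μ ∂((coinMeasure n).map X) := by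
        rw [hprod, hYmap]
        exact integral_prod _ Integrable.of_finite
    _ = ∫ z, 𝔼 b, G (z, b) ∂((coinMeasure n).map X) := by
        simp only [hμ, integral_pi_uniform]
    _ = ∫ ω, 𝔼 b, G (X ω, b) ∂coinMeasure n :=
        integral_map hXm.aemeasurable Measurable.of_discrete.aestronglyMeasurable
    _ = _ := by simp only [stepAvg, hG, hX, iterate_eq_iterateOfFinite rule x k]

theorem integral_iterate (rule : (Fin n → ℝ) → Matrix (Fin n) (Fin n) ℝ) (x : Fin n → ℝ)
    (k : ℕ) (F : (Fin n → ℝ) → ℝ) :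
    ∫ ω, F (iterate rule x ω k) ∂coinMeasure n = (stepAvg rule)^[k] F x := by
  induction k generalizing F with
  | zero => simp [iterate]
  | succ k ih => rw [integral_iterate_succ, ih, Function.iterate_succ_apply]

/-! ### Functions that do not increase on average -/

section

variable {A : Matrix (Fin m) (Fin n) ℝ} {rule : (Fin n → ℝ) → Matrix (Fin n) (Fin n) ℝ}
  (hrule : IsCovarianceRule A rule)
include hrule

theorem IsCovarianceRule.update_mem_cube {x : Fin n → ℝ} (hx : x ∈ cube n) (b : Fin n → Bool) :
    update (rule x) x (signs b) ∈ cube n := by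
  rcases Nat.eq_zero_or_pos n with rfl | hn
  · exact fun i => i.elim0
  · exact SubIsotropic.update_mem_cube hn hx (hrule x hx) b

theorem IsCovarianceRule.iterate_mem_cube {x : Fin n → ℝ} (hx : x ∈ cube n) (ω : Coins n)
    (k : ℕ) : iterate rule x ω k ∈ cube n := by
  induction k with
  | zero => exact hx
  | succ k ih => exact hrule.update_mem_cube ih _

theorem stepAvg_mono {F G : (Fin n → ℝ) → ℝ} (h : ∀ y ∈ cube n, F y ≤ G y) {x : Fin n → ℝ}
    (hx : x ∈ cube n) : stepAvg rule F x ≤ stepAvg rule G x :=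
  Finset.expect_le_expect fun b _ => h _ (hrule.update_mem_cube hx b)

theorem iterate_stepAvg_le {F : (Fin n → ℝ) → ℝ} (h : ∀ y ∈ cube n, stepAvg rule F y ≤ F y)
    (k : ℕ) : ∀ x ∈ cube n, (stepAvg rule)^[k] F x ≤ F x := by
  induction k with
  | zero => exact fun x _ => le_rfl
  | succ k ih =>
    intro x hx
    rw [Function.iterate_succ_apply']
    exact (stepAvg_mono hrule ih hx).trans (h x hx)

end

/-! ### Termination -/

theorem isZeroOne_iff_alive_eq_empty {x : Fin n → ℝ} (hx : x ∈ cube n) :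
    IsZeroOne x ↔ alive x = ∅ := by
  simp only [Finset.eq_empty_iff_forall_notMem, mem_alive, IsZeroOne, not_and_or, not_lt]
  refine forall_congr' fun i => or_congr ?_ ?_
  · exact ⟨fun h => h.le, fun h => le_antisymm h (hx i).1⟩
  · exact ⟨fun h => h.ge, fun h => le_antisymm (hx i).2 h⟩

theorem update_eq_self {A : Matrix (Fin m) (Fin n) ℝ} {x : Fin n → ℝ}
    {U : Matrix (Fin n) (Fin n) ℝ} (hU : IsUpdateCovariance A x U) (hx : x ∈ cube n)
    (h : IsZeroOne x) (b : Fin n → Bool) : update U x (signs b) = x := by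
  rw [isZeroOne_iff_alive_eq_empty hx] at h
  ext i
  rw [update_eq, Pi.add_apply, hU.increment_eq_zero b (by simp [h]), add_zero]

/-- The potential that bounds the number of remaining iterations. -/
def remaining (x : Fin n → ℝ) : ℝ :=
  40 * n ^ 2 * (alive x).card + 80 * n ^ 3 * ∑ i, x i * (1 - x i)

theorem remaining_nonneg {x : Fin n → ℝ} (hx : x ∈ cube n) : 0 ≤ remaining x := by
  have : 0 ≤ ∑ i, x i * (1 - x i) := Finset.sum_nonneg fun i _ =>
    mul_nonneg (hx i).1 (by linarith [(hx i).2])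
  unfold remaining
  positivity

theorem remaining_le (x : Fin n → ℝ) : remaining x ≤ 60 * n ^ 4 := by
  have h1 : ((alive x).card : ℝ) ≤ n := by
    exact_mod_cast (Finset.card_le_univ _).trans_eq (Fintype.card_fin n)
  have h2 : ∑ i, x i * (1 - x i) ≤ ∑ _i : Fin n, (1 / 4 : ℝ) :=
    Finset.sum_le_sum fun i _ => by nlinarith [sq_nonneg (x i - 1 / 2)]
  rw [Finset.sum_const, Finset.card_univ, Fintype.card_fin, nsmul_eq_mul] at h2
  calc remaining x ≤ 40 * n ^ 2 * n + 80 * n ^ 3 * (n * (1 / 4)) := by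
        unfold remaining
        gcongr
    _ = 40 * (n : ℝ) ^ 3 + 20 * n ^ 4 := by ring
    _ ≤ 40 * (n : ℝ) ^ 4 + 20 * n ^ 4 := by
        rcases Nat.eq_zero_or_pos n with rfl | hn
        · simp
        · have : (1 : ℝ) ≤ n := by exact_mod_cast hn
          have := pow_le_pow_right₀ this (by norm_num : 3 ≤ 4)
          linarith
    _ = 60 * n ^ 4 := by ring

/-- The lost variance term is at least 20 tr U - 20n²p, and 20 tr U is at least the number of alive
coordinates. The loss 20n²p is at most 40n² times the probability of freezing, which the first term
of `remaining` pays. -/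
theorem expect_remaining_update_le {A : Matrix (Fin m) (Fin n) ℝ} {x : Fin n → ℝ}
    {U : Matrix (Fin n) (Fin n) ℝ} (hU : IsUpdateCovariance A x U) (hx : x ∈ cube n)
    (h : ¬IsZeroOne x) : 𝔼 b, remaining (update U x (signs b)) ≤ remaining x - 1 := by
  rw [isZeroOne_iff_alive_eq_empty hx, ← Finset.card_eq_zero, ← ne_eq, ← Nat.pos_iff_ne_zero] at h
  have hn : 0 < n := h.trans_le ((Finset.card_le_univ _).trans_eq (Fintype.card_fin n))
  have hn' : (0 : ℝ) < n := by exact_mod_cast hn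
  have hN : (1 : ℝ) ≤ (alive x).card := by exact_mod_cast h
  have h1 : ∀ b, remaining (update U x (signs b)) ≤ remaining x - 40 * n ^ 2 * freezes U x b
      + 80 * n ^ 3 * ((fun i => 1 - 2 * x i) ⬝ᵥ increment U x b)
      - 80 * n ^ 3 * ∑ i, increment U x b i ^ 2 := by
    intro b
    have h2 := card_alive_update_add_freezes_le hU b
    have h3 : ∑ i, update U x (signs b) i * (1 - update U x (signs b) i) =
        ∑ i, x i * (1 - x i) + (fun i => 1 - 2 * x i) ⬝ᵥ increment U x b
          - ∑ i, increment U x b i ^ 2 := by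
      rw [dotProduct, ← Finset.sum_add_distrib, ← Finset.sum_sub_distrib]
      refine Finset.sum_congr rfl fun i _ => ?_
      rw [update_eq, Pi.add_apply]
      ring
    have h4 := mul_le_mul_of_nonneg_left h2 (by positivity : (0 : ℝ) ≤ 40 * n ^ 2)
    rw [remaining, remaining, h3]
    linarith
  have h5 : 𝔼 b, remaining (update U x (signs b)) ≤ remaining x
      - 40 * n ^ 2 * 𝔼 b, freezes U x b - 80 * n ^ 3 * ∑ i, 𝔼 b, increment U x b i ^ 2 := by
    refine (Finset.expect_le_expect fun b _ => h1 b).trans_eq ?_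
    rw [Finset.expect_sub_distrib, Finset.expect_add_distrib, Finset.expect_sub_distrib,
      ← Finset.mul_expect, ← Finset.mul_expect, ← Finset.mul_expect, expect_dotProduct_increment,
      Finset.expect_sum_comm]
    simp
  have h6 : maxStep n ^ 2 * U.trace ≤ ∑ i, 𝔼 b, increment U x b i ^ 2
      + n * (shortProb U x / (4 * n ^ 2)) := by
    have : ∑ i, maxStep n ^ 2 * U i i ≤ _ :=
      Finset.sum_le_sum fun i _ => maxStep_sq_mul_diag_le hn hx hU i
    rw [Finset.sum_add_distrib, ← Finset.mul_sum, Finset.sum_const, Finset.card_univ,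
      Fintype.card_fin, nsmul_eq_mul] at this
    exact this
  have h7 := hU.trace_ge
  have h8 := shortProb_le_expect_freezes hn hx hU
  rw [maxStep_sq] at h6
  have h9 := mul_le_mul_of_nonneg_left h6 (by positivity : (0 : ℝ) ≤ 80 * n ^ 3)
  have e1 : 80 * (n : ℝ) ^ 3 * (1 / (4 * n ^ 3) * U.trace) = 20 * U.trace := by
    field_simp; ring
  have e2 : 80 * (n : ℝ) ^ 3 * (n * (shortProb U x / (4 * n ^ 2))) = 20 * n ^ 2 * shortProb U x := by
    field_simp; ring
  rw [mul_add, e1, e2] at h9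
  have h10 := mul_le_mul_of_nonneg_left h8 (by positivity : (0 : ℝ) ≤ 20 * n ^ 2)
  rw [slack] at h7
  linarith

section

variable {A : Matrix (Fin m) (Fin n) ℝ} {rule : (Fin n → ℝ) → Matrix (Fin n) (Fin n) ℝ}
  (hrule : IsCovarianceRule A rule) {x : Fin n → ℝ} (hx : x ∈ cube n)

/-- The runs that are not finished after `k` iterations. -/
def unfinished (rule : (Fin n → ℝ) → Matrix (Fin n) (Fin n) ℝ) (x : Fin n → ℝ) (k : ℕ) :
    Set (Coins n) :=
  {ω | ¬IsZeroOne (iterate rule x ω k)}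

theorem measurableSet_unfinished (rule : (Fin n → ℝ) → Matrix (Fin n) (Fin n) ℝ) (x : Fin n → ℝ)
    (k : ℕ) : MeasurableSet (unfinished rule x k) :=
  measurable_comp_iterate rule x k (fun y => ¬IsZeroOne y) |>.setOf

include hrule hx

open Classical in
-- Telescope the expected drop of `remaining`; finished runs stay put and contribute nothing.
theorem sum_measureReal_unfinished_le (k : ℕ) :
    ∑ j ∈ Finset.range k, (coinMeasure n).real (unfinished rule x j) ≤ 60 * n ^ 4 := by
  have h1 : ∀ j, (coinMeasure n).real (unfinished rule x j)
      + ∫ ω, remaining (iterate rule x ω (j + 1)) ∂coinMeasure n ≤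
        ∫ ω, remaining (iterate rule x ω j) ∂coinMeasure n := by
    intro j
    have h2 : (coinMeasure n).real (unfinished rule x j) =
        ∫ ω, (fun y => if IsZeroOne y then (0 : ℝ) else 1) (iterate rule x ω j) ∂coinMeasure n := by
      rw [← integral_indicator_one (measurableSet_unfinished rule x j)]
      refine integral_congr_ae (Filter.Eventually.of_forall fun ω => ?_)
      by_cases h : IsZeroOne (iterate rule x ω j) <;> simp [unfinished, h]
    have i1 := integrable_comp_iterate rule x j fun y => if IsZeroOne y then (0 : ℝ) else 1
    have i2 := integrable_comp_iterate rule x j (stepAvg rule remaining)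
    rw [integral_iterate_succ, h2, ← integral_add i1 i2]
    refine integral_mono (i1.add i2) (integrable_comp_iterate rule x j _) fun ω => ?_
    have hy := hrule.iterate_mem_cube hx ω j
    simp only
    split_ifs with h
    · simp [stepAvg, update_eq_self (hrule _ hy) hy h]
    · have := expect_remaining_update_le (hrule _ hy) hy h
      unfold stepAvg
      linarith
  have h3 : ∑ j ∈ Finset.range k, (coinMeasure n).real (unfinished rule x j)
      + ∫ ω, remaining (iterate rule x ω k) ∂coinMeasure n ≤ remaining x := by
    induction k with
    | zero => simp [iterate]
    | succ k ih =>
      rw [Finset.sum_range_succ]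
      linarith [h1 k]
  have h4 : 0 ≤ ∫ ω, remaining (iterate rule x ω k) ∂coinMeasure n :=
    integral_nonneg fun ω => remaining_nonneg (hrule.iterate_mem_cube hx ω k)
  linarith [remaining_le x]

theorem tsum_measure_unfinished_le :
    ∑' k, coinMeasure n (unfinished rule x k) ≤ ENNReal.ofReal (60 * n ^ 4) := by
  refine ENNReal.tsum_le_of_sum_range_le fun k => ?_
  refine le_trans (le_of_eq ?_)
    (ENNReal.ofReal_le_ofReal (sum_measureReal_unfinished_le hrule hx k))
  rw [ENNReal.ofReal_sum_of_nonneg fun _ _ => measureReal_nonneg]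
  exact Finset.sum_congr rfl fun j _ => (ofReal_measureReal).symm

theorem tendsto_measureReal_unfinished :
    Filter.Tendsto (fun k => (coinMeasure n).real (unfinished rule x k)) Filter.atTop (𝓝 0) :=
  (summable_of_sum_range_le (fun _ => measureReal_nonneg)
    (sum_measureReal_unfinished_le hrule hx)).tendsto_atTop_zero

theorem ae_exists_isZeroOne :
    ∀ᵐ ω ∂coinMeasure n, ∃ k, IsZeroOne (iterate rule x ω k) := by
  have h := ae_eventually_notMem ((tsum_measure_unfinished_le hrule hx).trans_lt
    ENNReal.ofReal_lt_top).ne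
  filter_upwards [h] with ω hω
  obtain ⟨k, hk⟩ := hω.exists
  exact ⟨k, not_not.1 hk⟩

/-- Pointwise, `numIter` is at most the number of times at which the run is unfinished; on runs that
never finish it is `sInf ∅ = 0`. -/
theorem lintegral_numIter_le :
    ∫⁻ ω, (numIter rule x ω : ℝ≥0∞) ∂coinMeasure n ≤ ENNReal.ofReal (60 * n ^ 4) := by
  refine le_trans ?_ (tsum_measure_unfinished_le hrule hx)
  have h : ∀ k, coinMeasure n (unfinished rule x k) =
      ∫⁻ ω, (unfinished rule x k).indicator 1 ω ∂coinMeasure n := fun k =>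
    (lintegral_indicator_one (measurableSet_unfinished rule x k)).symm
  simp only [h]
  rw [← lintegral_tsum fun k =>
    (measurable_one.indicator (measurableSet_unfinished rule x k)).aemeasurable]
  refine lintegral_mono fun ω => ?_
  refine le_trans ?_ (ENNReal.sum_le_tsum (Finset.range (numIter rule x ω)))
  have h2 : ∀ k ∈ Finset.range (numIter rule x ω),
      (unfinished rule x k).indicator (1 : Coins n → ℝ≥0∞) ω = 1 := fun k hk =>
    Set.indicator_of_mem (s := unfinished rule x k)
      (Nat.notMem_of_lt_sInf (Finset.mem_range.1 hk)) 1
  rw [Finset.sum_congr rfl h2]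
  simp

/-! ### The output -/

theorem iterate_add_eq {ω : Coins n} {k : ℕ} (h : IsZeroOne (iterate rule x ω k)) (j : ℕ) :
    iterate rule x ω (k + j) = iterate rule x ω k := by
  induction j with
  | zero => rfl
  | succ j ih =>
    have hy := hrule.iterate_mem_cube hx ω k
    rw [← add_assoc, iterate, ih]
    exact update_eq_self (hrule _ hy) hy h _

theorem output_eq_iterate {ω : Coins n} {k : ℕ} (h : IsZeroOne (iterate rule x ω k)) :
    output rule x ω = iterate rule x ω k := by
  have h1 : numIter rule x ω ≤ k := Nat.sInf_le h
  have h2 : IsZeroOne (iterate rule x ω (numIter rule x ω)) :=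
    Nat.sInf_mem (s := {k | IsZeroOne (iterate rule x ω k)}) ⟨k, h⟩
  obtain ⟨j, rfl⟩ := Nat.exists_eq_add_of_le h1
  rw [iterate_add_eq hrule hx h2, output]

theorem ae_isZeroOne_output : ∀ᵐ ω ∂coinMeasure n, IsZeroOne (output rule x ω) := by
  filter_upwards [ae_exists_isZeroOne hrule hx] with ω hω
  exact Nat.sInf_mem (s := {k | IsZeroOne (iterate rule x ω k)}) hω

theorem output_mem_cube (ω : Coins n) : output rule x ω ∈ cube n :=
  hrule.iterate_mem_cube hx ω _

/-- The output is the almost sure limit of the iterates, which are eventually constant. -/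
theorem aestronglyMeasurable_output (i : Fin n) :
    AEStronglyMeasurable (fun ω => output rule x ω i) (coinMeasure n) := by
  refine aestronglyMeasurable_of_tendsto_ae Filter.atTop
    (f := fun k ω => iterate rule x ω k i)
    (fun k => (measurable_comp_iterate rule x k fun y => y i).aestronglyMeasurable) ?_
  filter_upwards [ae_exists_isZeroOne hrule hx] with ω ⟨k, hk⟩
  refine tendsto_const_nhds.congr' ?_
  filter_upwards [Filter.eventually_ge_atTop k] with j hj
  obtain ⟨l, rfl⟩ := Nat.exists_eq_add_of_le hj
  rw [output_eq_iterate hrule hx hk, iterate_add_eq hrule hx hk]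

theorem integrable_output (i : Fin n) :
    Integrable (fun ω => output rule x ω i) (coinMeasure n) := by
  refine Integrable.of_bound (aestronglyMeasurable_output hrule hx i) 1
    (Filter.Eventually.of_forall fun ω => ?_)
  have := output_mem_cube hrule hx ω i
  rw [Real.norm_eq_abs, abs_le]
  constructor <;> linarith

/-- Bounds on probabilities pass from the iterates to the output. -/
theorem measureReal_output_le {S : Set (Fin n → ℝ)} {B : ℝ}
    (h : ∀ k, (coinMeasure n).real {ω | iterate rule x ω k ∈ S} ≤ B) :
    (coinMeasure n).real {ω | output rule x ω ∈ S} ≤ B := by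
  have h1 : ∀ k, (coinMeasure n).real {ω | output rule x ω ∈ S} ≤
      B + (coinMeasure n).real (unfinished rule x k) := by
    intro k
    calc (coinMeasure n).real {ω | output rule x ω ∈ S}
        ≤ (coinMeasure n).real ({ω | iterate rule x ω k ∈ S} ∪ unfinished rule x k) := by
          refine measureReal_mono fun ω hω => ?_
          by_cases hk : IsZeroOne (iterate rule x ω k)
          · left
            change output rule x ω ∈ S at hω
            rwa [output_eq_iterate hrule hx hk] at hω
          · exact Or.inr hk
      _ ≤ _ := (measureReal_union_le _ _).trans (by linarith [h k])
  have h2 := (tendsto_measureReal_unfinished hrule hx).const_add B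
  rw [add_zero] at h2
  exact ge_of_tendsto' h2 h1

omit hrule hx in
theorem integral_iterate_apply (k : ℕ) (i : Fin n) :
    ∫ ω, iterate rule x ω k i ∂coinMeasure n = x i := by
  induction k with
  | zero => simp [iterate]
  | succ k ih =>
    rw [integral_iterate_succ rule x k fun y => y i, ← ih]
    refine integral_congr_ae (Filter.Eventually.of_forall fun ω => ?_)
    have := expect_dotProduct_increment (rule (iterate rule x ω k)) (iterate rule x ω k)
      (Pi.single i 1)
    simp only [single_dotProduct, one_mul] at this
    simp only [stepAvg, update_eq, Pi.add_apply, Finset.expect_add_distrib, this]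
    simp

theorem integral_output (i : Fin n) : ∫ ω, output rule x ω i ∂coinMeasure n = x i := by
  refine tendsto_nhds_unique (f := fun k => ∫ ω, iterate rule x ω k i ∂coinMeasure n)
    (l := Filter.atTop) ?_ ?_
  · refine tendsto_integral_of_dominated_convergence (fun _ => 1)
      (fun k => (measurable_comp_iterate rule x k fun y => y i).aestronglyMeasurable)
      (integrable_const 1) (fun k => Filter.Eventually.of_forall fun ω => ?_) ?_
    · have := hrule.iterate_mem_cube hx ω k i
      rw [Real.norm_eq_abs, abs_le]
      constructor <;> linarith
    · filter_upwards [ae_exists_isZeroOne hrule hx] with ω ⟨k, hk⟩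
      refine tendsto_const_nhds.congr' ?_
      filter_upwards [Filter.eventually_ge_atTop k] with j hj
      obtain ⟨l, rfl⟩ := Nat.exists_eq_add_of_le hj
      rw [output_eq_iterate hrule hx hk, iterate_add_eq hrule hx hk]
  · simp only [integral_iterate_apply]
    exact tendsto_const_nhds

end

/-! ### Exponential moments of the iterates -/

/-- By concavity `saturation` lies above its chord on [0,1], and the chord values at `t` and `1 - t`
add up to `saturation n 1`. -/
theorem weight_nonneg {t : ℝ} (h0 : 0 ≤ t) (h1 : t ≤ 1) : 0 ≤ weight n t := by
  have hn : (0 : ℝ) ≤ n := Nat.cast_nonneg n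
  have key : ∀ s : ℝ, 0 ≤ s → s ≤ 1 → s / (1 + n) ≤ saturation n s := by
    intro s hs hs'
    unfold saturation
    gcongr
    nlinarith
  have h2 := key t h0 h1
  have h3 := key (1 - t) (by linarith) (by linarith)
  have h4 : saturation n 1 = t / (1 + n) + (1 - t) / (1 + n) := by
    unfold saturation
    rw [← add_div]
    simp
  unfold weight
  nlinarith [mul_nonneg h0 (sub_nonneg.2 h1)]

theorem potential_nonneg (a : Fin n → ℝ) {x : Fin n → ℝ} (hx : x ∈ cube n) :
    0 ≤ potential a x := by
  have h0 : 0 ≤ ∑ i, a i ^ 2 * (x i * (1 - x i)) := Finset.sum_nonneg fun i _ =>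
    mul_nonneg (sq_nonneg _) (mul_nonneg (hx i).1 (by linarith [(hx i).2]))
  have h1 : 0 ≤ ∑ i, a i ^ 2 * weight n (x i) := Finset.sum_nonneg fun i _ =>
    mul_nonneg (sq_nonneg _) (weight_nonneg (hx i).1 (hx i).2)
  unfold potential
  positivity

/-- The comparison is needed only on a set that steps do not leave: the cube, or a face with the
frozen coordinates fixed. -/
theorem iterate_stepAvg_mono {rule : (Fin n → ℝ) → Matrix (Fin n) (Fin n) ℝ}
    {S : Set (Fin n → ℝ)} (hS : ∀ y ∈ S, ∀ b, update (rule y) y (signs b) ∈ S)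
    {F G : (Fin n → ℝ) → ℝ} (h : ∀ y ∈ S, F y ≤ G y) (k : ℕ) :
    ∀ x ∈ S, (stepAvg rule)^[k] F x ≤ (stepAvg rule)^[k] G x := by
  induction k with
  | zero => exact h
  | succ k ih =>
    intro x hx
    rw [Function.iterate_succ_apply', Function.iterate_succ_apply']
    exact Finset.expect_le_expect fun b _ => ih _ (hS x hx b)

section

variable {A : Matrix (Fin m) (Fin n) ℝ} {rule : (Fin n → ℝ) → Matrix (Fin n) (Fin n) ℝ}
  (hrule : IsCovarianceRule A rule)
include hrule

theorem iterate_stepAvg_exp_le {a : Fin n → ℝ} (ha : ∀ i, |a i| ≤ 1 / 500) (r : ℝ) (k : ℕ)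
    {x : Fin n → ℝ} (hx : x ∈ cube n) :
    (stepAvg rule)^[k] (fun y => Real.exp (a ⬝ᵥ y + r)) x ≤
      Real.exp (a ⬝ᵥ x + r + 752 * ∑ i, a i ^ 2 * (x i - x i ^ 2)) := by
  set G : (Fin n → ℝ) → ℝ := fun y => Real.exp (a ⬝ᵥ y + potential a y) * Real.exp r with hG
  have h1 : ∀ y ∈ cube n, stepAvg rule G y ≤ G y := by
    intro y hy
    rcases Nat.eq_zero_or_pos n with rfl | hn
    · have h2 : ∀ b, update (rule y) y (signs b) = y := fun b => Subsingleton.elim _ _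
      simp [stepAvg, h2]
    · simp only [stepAvg, hG, ← Finset.expect_mul]
      gcongr
      exact expect_exp_update_le hn hy (hrule y hy) ha
  calc (stepAvg rule)^[k] (fun y => Real.exp (a ⬝ᵥ y + r)) x ≤ (stepAvg rule)^[k] G x := by
        refine iterate_stepAvg_mono (S := cube n) (fun y hy b => hrule.update_mem_cube hy b)
          (fun y hy => ?_) k x hx
        simp only [hG]
        rw [← Real.exp_add, Real.exp_le_exp]
        linarith [potential_nonneg a hy]
    _ ≤ G x := iterate_stepAvg_le hrule h1 k x hx
    _ ≤ _ := by
        simp only [hG]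
        rw [← Real.exp_add, Real.exp_le_exp]
        linarith [potential_le (a := a) hx]

omit hrule in
theorem measureReal_iterate_le (a : Fin n → ℝ) (x : Fin n → ℝ) (k : ℕ) (t : ℝ) {θ : ℝ}
    (hθ : 0 ≤ θ) :
    (coinMeasure n).real {ω | iterate rule x ω k ∈ {y | t ≤ a ⬝ᵥ y - a ⬝ᵥ x}} ≤
      Real.exp (-θ * t) * (stepAvg rule)^[k] (fun y => Real.exp (θ * (a ⬝ᵥ y - a ⬝ᵥ x))) x := by
  rw [← integral_iterate rule x k fun y => Real.exp (θ * (a ⬝ᵥ y - a ⬝ᵥ x))]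
  exact ProbabilityTheory.measure_ge_le_exp_mul_mgf
    (X := fun ω => a ⬝ᵥ iterate rule x ω k - a ⬝ᵥ x) t hθ
    (integrable_comp_iterate rule x k fun y => Real.exp (θ * (a ⬝ᵥ y - a ⬝ᵥ x)))

/-! ### Concentration -/

variable {x : Fin n → ℝ} (hx : x ∈ cube n)
include hx

theorem measureReal_output_tail_le (a : Fin n → ℝ) {t : ℝ} (ht : 0 ≤ t) :
    (coinMeasure n).real {ω | output rule x ω ∈ {y | t ≤ a ⬝ᵥ y - a ⬝ᵥ x}} ≤
      Real.exp (-(t ^ 2 / 1504) /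
        (2 * (∑ i, a i ^ 2 * (x i - x i ^ 2) + (⨆ i, |a i|) * t / 3))) := by
  set V := ∑ i, a i ^ 2 * (x i - x i ^ 2) with hV
  set M := ⨆ i, |a i| with hM
  have hV0 : 0 ≤ V := Finset.sum_nonneg fun i _ =>
    mul_nonneg (sq_nonneg _) (by nlinarith [(hx i).1, (hx i).2])
  have hM1 : ∀ i, |a i| ≤ M := fun i =>
    le_ciSup (f := fun i => |a i|) (Set.finite_range _).bddAbove i
  have hM0 : 0 ≤ M := Real.iSup_nonneg fun i => abs_nonneg _
  rcases (add_nonneg hV0 (div_nonneg (mul_nonneg hM0 ht) (by norm_num : (0 : ℝ) ≤ 3))).eq_or_lt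
    with h0 | h0
  -- A zero denominator makes the exponent 0, so the bound is 1.
  · rw [← h0, mul_zero, div_zero, Real.exp_zero]
    exact measureReal_le_one
  have hD : 0 < 1504 * V + 500 * (M * t) := by nlinarith [mul_nonneg hM0 ht]
  -- The summand 500 M t ensures `θ |a i| ≤ 1/500`; 1504 = 2 · 752 makes the quadratic term at most
  -- θt/2. Since 1504/3 ≥ 500, β = 1504 suffices.
  set θ := t / (1504 * V + 500 * (M * t)) with hθ
  have hθ0 : 0 ≤ θ := by positivity
  have hθM : ∀ i, |(θ • a) i| ≤ 1 / 500 := by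
    intro i
    rw [Pi.smul_apply, smul_eq_mul, abs_mul, abs_of_nonneg hθ0, hθ, div_mul_eq_mul_div,
      div_le_div_iff₀ hD (by norm_num)]
    nlinarith [mul_le_mul_of_nonneg_left (hM1 i) ht]
  refine measureReal_output_le hrule hx fun k => ?_
  refine (measureReal_iterate_le a x k t hθ0).trans ?_
  have h1 := iterate_stepAvg_exp_le hrule hθM (-(θ * (a ⬝ᵥ x))) k hx
  have e1 : ∀ y : Fin n → ℝ, (θ • a) ⬝ᵥ y + -(θ * (a ⬝ᵥ x)) = θ * (a ⬝ᵥ y - a ⬝ᵥ x) := by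
    intro y
    rw [smul_dotProduct, smul_eq_mul]
    ring
  have e2 : ∑ i, (θ • a) i ^ 2 * (x i - x i ^ 2) = θ ^ 2 * V := by
    rw [hV, Finset.mul_sum]
    refine Finset.sum_congr rfl fun i _ => ?_
    rw [Pi.smul_apply, smul_eq_mul]
    ring
  simp only [e1, e2, sub_self, mul_zero, zero_add] at h1
  calc Real.exp (-θ * t) * (stepAvg rule)^[k] (fun y => Real.exp (θ * (a ⬝ᵥ y - a ⬝ᵥ x))) x
      ≤ Real.exp (-θ * t) * Real.exp (752 * (θ ^ 2 * V)) := by gcongr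
    _ = Real.exp (-θ * t + 752 * (θ ^ 2 * V)) := (Real.exp_add _ _).symm
    _ ≤ _ := by
        rw [Real.exp_le_exp]
        have h2 : θ * (1504 * V + 500 * (M * t)) = t := div_mul_cancel₀ _ hD.ne'
        have h3 : 752 * (θ ^ 2 * V) ≤ θ * t / 2 := by
          calc 752 * (θ ^ 2 * V) = θ * (θ * (1504 * V)) / 2 := by ring
            _ ≤ θ * (θ * (1504 * V + 500 * (M * t))) / 2 := by
                gcongr
                linarith [mul_nonneg hM0 ht]
            _ = θ * t / 2 := by rw [h2]
        have h4 : t ^ 2 / 1504 / (2 * (V + M * t / 3)) ≤ θ * t / 2 := by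
          rw [hθ, div_mul_eq_mul_div, div_div, div_div,
            div_le_div_iff₀ (by positivity) (by positivity)]
          nlinarith [mul_nonneg hM0 ht, mul_nonneg (sq_nonneg t) (mul_nonneg hM0 ht)]
        rw [neg_div]
        linarith

omit hrule in
theorem integral_dotProduct_output (hrule : IsCovarianceRule A rule) (a : Fin n → ℝ) :
    ∫ ω, a ⬝ᵥ output rule x ω ∂coinMeasure n = a ⬝ᵥ x := by
  simp only [dotProduct]
  rw [integral_finsetSum _ fun i _ => (integrable_output hrule hx i).const_mul _]
  exact Finset.sum_congr rfl fun i _ => by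
    rw [integral_const_mul, integral_output hrule hx i]

theorem isConcentrated_output :
    IsConcentrated (coinMeasure n) (output rule x) x 1504 where
  zeroOne := ae_isZeroOne_output hrule hx
  integrable := integrable_output hrule hx
  mean := integral_output hrule hx
  tail a t ht := by
    rw [integral_dotProduct_output hx hrule]
    exact measureReal_output_tail_le hrule hx a ht

end

/-! ### Discrepancy of a row -/

theorem IsUpdateCovariance.dotProduct_update_of_isBigRow {A : Matrix (Fin m) (Fin n) ℝ}
    {x : Fin n → ℝ} {U : Matrix (Fin n) (Fin n) ℝ} (hU : IsUpdateCovariance A x U) {i : Fin m}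
    (hi : IsBigRow A x i) (b : Fin n → Bool) : A i ⬝ᵥ update U x (signs b) = A i ⬝ᵥ x := by
  have h1 : (fun j => if j ∈ alive x then A i j else 0) ⬝ᵥ increment U x b = 0 :=
    dotProduct_increment_eq_zero hU.posSemidef
      (hU.orthogonal _ (Submodule.subset_span ⟨i, hi, rfl⟩)) x b
  have h2 : A i ⬝ᵥ increment U x b
      = (fun j => if j ∈ alive x then A i j else 0) ⬝ᵥ increment U x b := by
    refine Finset.sum_congr rfl fun j _ => ?_
    by_cases hj : j ∈ alive x
    · simp [hj]
    · rw [hU.increment_eq_zero b hj, mul_zero, mul_zero]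
  rw [update_eq, dotProduct_add, h2, h1, add_zero]

/-- The points that can be reached from `x`: frozen coordinates do not change. -/
def face (x : Fin n → ℝ) : Set (Fin n → ℝ) := {z | z ∈ cube n ∧ ∀ j, j ∉ alive x → z j = x j}

/-- Splitting a linear function on a face into its small and its large coefficients. -/
theorem dotProduct_sub_le_of_mem_face {x z a : Fin n → ℝ} (hx : x ∈ cube n) (hz : z ∈ face x)
    {s q : ℝ} (hs : 0 < s) (hq : ∑ j ∈ alive x, a j ^ 2 ≤ q) :
    a ⬝ᵥ z - a ⬝ᵥ x ≤ (fun j => if |a j| ≤ s then a j else 0) ⬝ᵥ z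
      - (fun j => if |a j| ≤ s then a j else 0) ⬝ᵥ x + q / s := by
  have h1 : a ⬝ᵥ z - a ⬝ᵥ x ≤ (fun j => if |a j| ≤ s then a j else 0) ⬝ᵥ z
      - (fun j => if |a j| ≤ s then a j else 0) ⬝ᵥ x
      + ∑ j, if j ∈ alive x then a j ^ 2 / s else 0 := by
    simp only [dotProduct, ← Finset.sum_sub_distrib, ← Finset.sum_add_distrib]
    refine Finset.sum_le_sum fun j _ => ?_
    by_cases hj : j ∈ alive x
    · rw [if_pos hj]
      split_ifs with h
      · linarith [div_nonneg (sq_nonneg (a j)) hs.le]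
      -- A large coefficient is bounded through its square, and its coordinate moves by at most 1.
      · have h2 : |a j| ≤ a j ^ 2 / s := by
          rw [le_div_iff₀ hs, ← sq_abs]
          nlinarith [not_le.1 h, abs_nonneg (a j)]
        have h3 : |z j - x j| ≤ 1 := by
          rw [abs_le]
          constructor <;> linarith [(hx j).1, (hx j).2, (hz.1 j).1, (hz.1 j).2]
        have h4 : a j * (z j - x j) ≤ |a j| * 1 := by
          refine (le_abs_self _).trans ?_
          rw [abs_mul]
          gcongr
        linarith
    · rw [if_neg hj, hz.2 j hj]
      linarith
  have h2 : ∑ j, (if j ∈ alive x then a j ^ 2 / s else 0) ≤ q / s := by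
    rw [← Finset.sum_filter, Finset.filter_mem_eq_inter, Finset.univ_inter, ← Finset.sum_div]
    gcongr
  linarith

section

variable {A : Matrix (Fin m) (Fin n) ℝ} {rule : (Fin n → ℝ) → Matrix (Fin n) (Fin n) ℝ}
  (hrule : IsCovarianceRule A rule)
include hrule

theorem IsCovarianceRule.update_mem_face {x z : Fin n → ℝ} (hz : z ∈ face x) (b : Fin n → Bool) :
    update (rule z) z (signs b) ∈ face x := by
  refine ⟨hrule.update_mem_cube hz.1 b, fun j hj => ?_⟩
  have h : j ∉ alive z := by rwa [mem_alive, hz.2 j hj, ← mem_alive]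
  rw [update_eq, Pi.add_apply, (hrule z hz.1).increment_eq_zero b h, add_zero, hz.2 j hj]

/-- Sub-Gaussian moments, after the row has become small. -/
theorem iterate_stepAvg_exp_le_of_small {a : Fin n → ℝ} {τ l : ℝ} (hτ : 0 < τ) (hl : 0 < l)
    {x : Fin n → ℝ} (hx : x ∈ cube n) (ha : ∑ j ∈ alive x, a j ^ 2 ≤ 2 * τ ^ 2) (k : ℕ) :
    (stepAvg rule)^[k] (fun y => Real.exp (l / (500 * τ) * (a ⬝ᵥ y - a ⬝ᵥ x))) x ≤
      Real.exp (l ^ 2 / 100) := by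
  set θ := l / (500 * τ) with hθ
  have hθ0 : 0 < θ := by positivity
  -- The cut-off is the largest for which `θ • c` meets the bound 1/500. The coefficients above it
  -- cost θ · 2τl = l²/250 in the exponent.
  set c : Fin n → ℝ := fun j => if |a j| ≤ τ / l then a j else 0 with hc
  have hc1 : ∀ i, |(θ • c) i| ≤ 1 / 500 := by
    intro i
    have h2 : |c i| ≤ τ / l := by
      simp only [hc]
      split_ifs with h
      · exact h
      · rw [abs_zero]; positivity
    rw [Pi.smul_apply, smul_eq_mul, abs_mul, abs_of_pos hθ0]
    calc θ * |c i| ≤ θ * (τ / l) := by gcongr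
      _ = 1 / 500 := by rw [hθ]; field_simp
  set r := θ * (2 * τ ^ 2 / (τ / l)) - θ * (c ⬝ᵥ x) with hr
  have h1 : (stepAvg rule)^[k] (fun y => Real.exp (θ * (a ⬝ᵥ y - a ⬝ᵥ x))) x ≤
      (stepAvg rule)^[k] (fun y => Real.exp ((θ • c) ⬝ᵥ y + r)) x := by
    refine iterate_stepAvg_mono (S := face x) (fun y hy b => hrule.update_mem_face hy b)
      (fun z hz => ?_) k x ⟨hx, fun _ _ => rfl⟩
    rw [Real.exp_le_exp]
    have h2 := dotProduct_sub_le_of_mem_face hx hz (by positivity : 0 < τ / l) ha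
    have h3 := mul_le_mul_of_nonneg_left h2 hθ0.le
    rw [smul_dotProduct, smul_eq_mul, hr]
    linarith
  refine h1.trans ((iterate_stepAvg_exp_le hrule hc1 r k hx).trans ?_)
  rw [Real.exp_le_exp]
  have h2 : ∑ i, (θ • c) i ^ 2 * (x i - x i ^ 2) ≤ θ ^ 2 * (2 * τ ^ 2 / 4) := by
    have h3 : ∀ i, (θ • c) i ^ 2 * (x i - x i ^ 2) ≤
        if i ∈ alive x then θ ^ 2 * (a i ^ 2 / 4) else 0 := by
      intro i
      split_ifs with hi
      · have h4 : c i ^ 2 ≤ a i ^ 2 := by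
          simp only [hc]
          split_ifs
          · exact le_rfl
          · simpa using sq_nonneg (a i)
        have h5 : x i - x i ^ 2 ≤ 1 / 4 := by nlinarith [sq_nonneg (x i - 1 / 2)]
        have h6 : 0 ≤ x i - x i ^ 2 := by nlinarith [(hx i).1, (hx i).2]
        rw [Pi.smul_apply, smul_eq_mul, mul_pow, mul_assoc]
        gcongr
        calc c i ^ 2 * (x i - x i ^ 2) ≤ a i ^ 2 * (1 / 4) := by gcongr
          _ = a i ^ 2 / 4 := by ring
      · have h4 : x i - x i ^ 2 = 0 := by
          rw [mem_alive, not_and_or, not_lt, not_lt] at hi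
          rcases hi with h | h
          · rw [le_antisymm h (hx i).1]; norm_num
          · rw [le_antisymm (hx i).2 h]; norm_num
        rw [h4, mul_zero]
    refine (Finset.sum_le_sum fun i _ => h3 i).trans ?_
    rw [← Finset.sum_filter, Finset.filter_mem_eq_inter, Finset.univ_inter, ← Finset.mul_sum,
      ← Finset.sum_div]
    gcongr
  have h3 : θ * (2 * τ ^ 2 / (τ / l)) = l ^ 2 / 250 := by
    rw [hθ]; field_simp; norm_num
  have h4 : θ ^ 2 * (2 * τ ^ 2 / 4) = l ^ 2 / 500000 := by
    rw [hθ]; field_simp; norm_num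
  rw [smul_dotProduct, smul_eq_mul, hr, h3]
  rw [h4] at h2
  linarith [sq_nonneg l]

/-- Sub-Gaussian moments for a row; as long as the row is big, it does not move. -/
theorem iterate_stepAvg_exp_row_le {i : Fin m} {a : Fin n → ℝ} (ha : a = A i ∨ a = -A i) {l : ℝ}
    (hl : 0 < l) (hA : 0 < maxColNorm A) (k : ℕ) :
    ∀ x ∈ cube n, (stepAvg rule)^[k]
      (fun y => Real.exp (l / (500 * maxColNorm A) * (a ⬝ᵥ y - a ⬝ᵥ x))) x ≤
      Real.exp (l ^ 2 / 100) := by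
  induction k with
  | zero =>
    intro x _
    simp only [Function.iterate_zero, id, sub_self, mul_zero, Real.exp_zero]
    exact Real.one_le_exp (by positivity)
  | succ k ih =>
    intro x hx
    -- This replaces a stopping time: a big row keeps its value, so the induction hypothesis at the
    -- next point applies. At the first point where it is small, the bound for small rows covers all
    -- remaining steps.
    by_cases hbig : IsBigRow A x i
    · rw [Function.iterate_succ_apply']
      have h1 : ∀ b, a ⬝ᵥ update (rule x) x (signs b) = a ⬝ᵥ x := by
        intro b
        have := (hrule x hx).dotProduct_update_of_isBigRow hbig b
        rcases ha with rfl | rfl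
        · exact this
        · rw [neg_dotProduct, neg_dotProduct, this]
      refine (Finset.expect_le_expect (g := fun _ => Real.exp (l ^ 2 / 100)) fun b _ => ?_).trans_eq
        (by simp)
      have h2 := ih _ (hrule.update_mem_cube hx b)
      rwa [h1 b] at h2
    · refine iterate_stepAvg_exp_le_of_small hrule hA hl hx ?_ (k + 1)
      have h1 : ∑ j ∈ alive x, A i j ^ 2 ≤ 2 * maxColNorm A ^ 2 := not_lt.1 hbig
      rcases ha with rfl | rfl
      · exact h1
      · simpa using h1

theorem measureReal_output_row_le {x : Fin n → ℝ} (hx : x ∈ cube n) {i : Fin m} {a : Fin n → ℝ}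
    (ha : a = A i ∨ a = -A i) {l : ℝ} (hl : 0 < l) (hA : 0 < maxColNorm A) (C : ℝ) :
    (coinMeasure n).real {ω | output rule x ω ∈
      {y | C * maxColNorm A * l ≤ a ⬝ᵥ y - a ⬝ᵥ x}} ≤
      Real.exp (-(C / 500 - 1 / 100) * l ^ 2) := by
  refine measureReal_output_le hrule hx fun k => ?_
  refine (measureReal_iterate_le a x k _ (by positivity : 0 ≤ l / (500 * maxColNorm A))).trans ?_
  calc Real.exp (-(l / (500 * maxColNorm A)) * (C * maxColNorm A * l)) * _
      ≤ Real.exp (-(l / (500 * maxColNorm A)) * (C * maxColNorm A * l)) *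
        Real.exp (l ^ 2 / 100) := by
        gcongr
        exact iterate_stepAvg_exp_row_le hrule ha hl hA k x hx
    _ = _ := by
        rw [← Real.exp_add]
        congr 1
        field_simp
        ring

omit hrule in
theorem maxColNorm_nonneg (A : Matrix (Fin m) (Fin n) ℝ) : 0 ≤ maxColNorm A :=
  Real.iSup_nonneg fun _ => Real.sqrt_nonneg _

omit hrule in
theorem eq_zero_of_maxColNorm_eq_zero (h : maxColNorm A = 0) : A = 0 := by
  ext i j
  have h1 := sum_sq_le_maxColNorm_sq A j
  have h2 : A i j ^ 2 ≤ ∑ i, A i j ^ 2 :=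
    Finset.single_le_sum (f := fun i => A i j ^ 2) (fun i _ => sq_nonneg _) (Finset.mem_univ i)
  rw [h] at h1
  have h3 : A i j ^ 2 = 0 := le_antisymm (by linarith) (sq_nonneg _)
  simpa using h3

/-- With C = 500(c + 3) each one-sided event has probability at most m^(-(c+2)). There are 2m ≤ m²
of them, which is where `2 ≤ m` enters. -/
theorem measureReal_discrepancy_le {x : Fin n → ℝ} (hx : x ∈ cube n) {c : ℝ} (hc : 0 < c)
    (hm : 2 ≤ m) :
    (coinMeasure n).real {ω | 500 * (c + 3) * maxColNorm A * √(Real.log m) <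
      ‖A.mulVec (output rule x ω - x)‖} ≤ (m : ℝ) ^ (-c) := by
  have hm' : (2 : ℝ) ≤ m := by exact_mod_cast hm
  have hm0 : (0 : ℝ) < m := by linarith
  have hlog : 0 < Real.log m := Real.log_pos (by linarith)
  set l := √(Real.log m) with hl
  have hl0 : 0 < l := Real.sqrt_pos.2 hlog
  have hl2 : l ^ 2 = Real.log m := Real.sq_sqrt hlog.le
  rcases (maxColNorm_nonneg A).eq_or_lt with h0 | h0
  · rw [eq_zero_of_maxColNorm_eq_zero h0.symm] at *
    rw [← h0]
    simp only [Matrix.zero_mulVec, norm_zero, mul_zero, zero_mul, lt_self_iff_false]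
    refine le_trans (le_of_eq ?_) (Real.rpow_nonneg hm0.le _)
    exact measureReal_empty
  set t := 500 * (c + 3) * maxColNorm A * l with ht
  have ht0 : 0 ≤ t := by positivity
  set S : (Fin n → ℝ) → Set (Coins n) := fun a =>
    {ω | output rule x ω ∈ {y | t ≤ a ⬝ᵥ y - a ⬝ᵥ x}} with hS
  have hsub : {ω | t < ‖A.mulVec (output rule x ω - x)‖} ⊆ ⋃ i, (S (A i) ∪ S (-A i)) := by
    intro ω hω
    have h1 : ¬‖A.mulVec (output rule x ω - x)‖ ≤ t := not_le.2 hω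
    rw [pi_norm_le_iff_of_nonneg ht0, not_forall] at h1
    obtain ⟨i, hi⟩ := h1
    rw [not_le, Real.norm_eq_abs, lt_abs] at hi
    have h2 : A.mulVec (output rule x ω - x) i = A i ⬝ᵥ output rule x ω - A i ⬝ᵥ x :=
      dotProduct_sub _ _ _
    rw [h2] at hi
    refine Set.mem_iUnion.2 ⟨i, hi.imp (fun h => h.le) fun h => ?_⟩
    change t ≤ (-A i) ⬝ᵥ output rule x ω - (-A i) ⬝ᵥ x
    rw [neg_dotProduct, neg_dotProduct]
    linarith
  have hbound : ∀ i a, (a = A i ∨ a = -A i) → (coinMeasure n).real (S a) ≤ (m : ℝ) ^ (-(c + 2)) := by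
    intro i a ha
    refine (measureReal_output_row_le hrule hx ha hl0 h0 (500 * (c + 3))).trans ?_
    rw [Real.rpow_def_of_pos hm0, Real.exp_le_exp, hl2]
    nlinarith
  calc (coinMeasure n).real {ω | t < ‖A.mulVec (output rule x ω - x)‖}
      ≤ (coinMeasure n).real (⋃ i, (S (A i) ∪ S (-A i))) := measureReal_mono hsub
    _ ≤ ∑ i, (coinMeasure n).real (S (A i) ∪ S (-A i)) := measureReal_iUnion_fintype_le _
    _ ≤ ∑ _i : Fin m, ((m : ℝ) ^ (-(c + 2)) + (m : ℝ) ^ (-(c + 2))) :=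
        Finset.sum_le_sum fun i _ => (measureReal_union_le _ _).trans
          (add_le_add (hbound i _ (Or.inl rfl)) (hbound i _ (Or.inr rfl)))
    _ = 2 * m * (m : ℝ) ^ (-(c + 2)) := by
        rw [Finset.sum_const, Finset.card_univ, Fintype.card_fin, nsmul_eq_mul]
        ring
    _ ≤ m * m * (m : ℝ) ^ (-(c + 2)) := by gcongr
    _ = (m : ℝ) ^ (-c) := by
        have : (m : ℝ) * m = (m : ℝ) ^ (2 : ℝ) := by rw [Real.rpow_two, sq]
        rw [this, ← Real.rpow_add hm0]
        congr 1
        ring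

end

end SubIsotropic

end

/-- Rounding in the Komlós setting. The norm on `Fin m → ℝ` is the maximum norm. -/
theorem mainTheorem6 :
    ∃ β : ℝ, 1 ≤ β ∧ ∃ K : ℝ, 0 < K ∧ ∀ c : ℝ, 0 < c → ∃ C : ℝ, 0 < C ∧
      ∀ (m n : ℕ) (A : Matrix (Fin m) (Fin n) ℝ),
        -- the algorithm never gets stuck: an admissible covariance matrix always exists
        (∀ y ∈ SubIsotropic.cube n, ∃ U, SubIsotropic.IsUpdateCovariance A y U) ∧
        -- whichever admissible matrices are used, the algorithm has all the stated properties
        ∀ rule : (Fin n → ℝ) → Matrix (Fin n) (Fin n) ℝ,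
          SubIsotropic.IsCovarianceRule A rule → ∀ x ∈ SubIsotropic.cube n,
            (∀ᵐ ω ∂SubIsotropic.coinMeasure n,
              ∃ k, SubIsotropic.IsZeroOne (SubIsotropic.iterate rule x ω k)) ∧
            ∫⁻ ω, (SubIsotropic.numIter rule x ω : ℝ≥0∞) ∂SubIsotropic.coinMeasure n ≤
              ENNReal.ofReal (K * (n : ℝ) ^ 4) ∧
            SubIsotropic.IsConcentrated (SubIsotropic.coinMeasure n)
              (SubIsotropic.output rule x) x β ∧
            (2 ≤ m →
              (SubIsotropic.coinMeasure n).real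
                {ω | C * SubIsotropic.maxColNorm A * √(Real.log m) <
                  ‖A.mulVec (SubIsotropic.output rule x ω - x)‖} ≤ (m : ℝ) ^ (-c)) := by
  refine ⟨1504, by norm_num, 60, by norm_num, fun c hc => ⟨500 * (c + 3), by positivity,
    fun m n A => ⟨fun y _ => SubIsotropic.exists_isUpdateCovariance A y, fun rule hrule x hx => ?_⟩⟩⟩
  exact ⟨SubIsotropic.ae_exists_isZeroOne hrule hx, SubIsotropic.lintegral_numIter_le hrule hx,
    SubIsotropic.isConcentrated_output hrule hx,
    fun hm => SubIsotropic.measureReal_discrepancy_le hrule hx hc hm⟩
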